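/- **Setting.** An $M$-antenna base station ($M\ge 1$) serves $M$ single-antenna users over Rayleigh block fading with blocks of $T$ symbols: the channel matrix $H\in\mathbb C^{M\times M}$ (row $h_k$ belongs to user $k$) has i.i.d. $\mathcal{CN}(0,1)$ entries, and all noise is $\mathcal{CN}(0,1)$. The base station has power $P>0$, split equally over $M$ unit-norm zero-forcing beams; each pilot has power $fP$ with $f\in(0,1]$. After $\beta$ pilots from every user, received (by reciprocity) as $\sqrt{fP}\,H+\text{noise}$, the base station forms the MMSE estimate $\hat H=\mathbb E[H\mid\text{pilots}]$ and uses as beams $\hat v_k$ the normalized columns of $\hat H^{-1}$. Treating interference as noise, user $k$ has the ergodic rate $$R^{\iota}(\beta M)=\mathbb E\log\Bigl(1+\frac{\frac PM|h_k\hat v_k|^2}{1+\frac PM\sum_{j\ne k}|h_k\hat v_j|^2+\iota}\Bigr).$$ Put $R_{\mathrm{DATA}}=R^{0}$ (no inter-node interference, INI) and $R_{\mathrm{INI}}=R^{\alpha fP}$ (INI of power $\alpha fP$). Let $R^{\mathrm{ZF}}=\mathbb E\log(1+\frac PM|h_kv_k|^2)$, where the $v_k$ are the zero-forcing beams for the true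 $H$, and $$\widetilde{\Delta R}_{\mathrm{INI}}=\log\frac{1+\alpha fP}{1+\frac{\alpha fP}{1+P/M}}.$$ For a training length $T_{\mathrm{tr}}\le T$ that is a multiple of $M$, the per-user spectral efficiencies of continuously adaptive beamforming (CAB, which sends data during training from the second cycle of $M$ pilot symbols on) and of its half-duplex counterpart are $$AR_{\mathrm{CAB}}(T_{\mathrm{tr}})=\tfrac{T-T_{\mathrm{tr}}}{T}R_{\mathrm{DATA}}(T_{\mathrm{tr}})+\tfrac1T\sum_{j=2}^{T_{\mathrm{tr}}/M}\bigl[R_{\mathrm{DATA}}((j-1)M)+(M-1)R_{\mathrm{INI}}((j-1)M)\bigr],$$ $$AR_{\mathrm{HD}}(T_{\mathrm{tr}})=\tfrac{T-T_{\mathrm{tr}}}{T}R_{\mathrm{DATA}}(T_{\mathrm{tr}}).$$ **Proposition.** All these rates are expectations of integrable random variables. The full-duplex gain $ARG=AR_{\mathrm{CAB}}(T_{\mathrm{tr}})-AR_{\mathrm{HD}}(T_{\mathrm{tr}})$ satisfies: 1. For every $\alpha>0$, $$ARG\ \ge\ \frac{T_{\mathrm{tr}}}{T}\bigl[R^{\mathrm{ZF}}-\widetilde{\Delta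 R}_{\mathrm{INI}}\bigr]-o\Bigl(\frac1{\sqrt T}\Bigr)\qquad(T\to\infty),$$ where the $o(1/\sqrt T)$ term depends only on $M,P,f,\alpha$ and $T$; in particular the bound is uniform over all multiples $T_{\mathrm{tr}}\le T$ of $M$. 2. For every $\alpha>0$, $ARG>0$ as soon as the training lasts at least two cycles, $2M\le T_{\mathrm{tr}}\le T$. 3. The gain is largest when INI is low: for fixed $T\ge 1$ and $T_{\mathrm{tr}}$, $ARG$ is nonincreasing in $\alpha\in[0,\infty)$, strictly decreasing if $M\ge2$ and $T_{\mathrm{tr}}\ge2M$. Likewise the bracket $R^{\mathrm{ZF}}-\widetilde{\Delta R}_{\mathrm{INI}}$ is strictly decreasing in $\alpha\in[0,\infty)$ and tends to $R^{\mathrm{ZF}}>0$ as $\alpha\downarrow0$. -/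

import Mathlib

open MeasureTheory ProbabilityTheory

namespace CAB

/-- The circularly symmetric complex Gaussian law `CN(0,1)`: independent real and imaginary
parts, each of mean `0` and variance `1/2`. -/
noncomputable def cgauss : Measure ℂ :=
  ((gaussianReal 0 (1 / 2)).prod (gaussianReal 0 (1 / 2))).map (fun p : ℝ × ℝ => ⟨p.1, p.2⟩)

theorem measurable_mk : Measurable (fun p : ℝ × ℝ => (⟨p.1, p.2⟩ : ℂ)) :=
  Complex.measurableEquivRealProd.symm.measurable

instance : IsProbabilityMeasure cgauss :=
  Measure.isProbabilityMeasure_map measurable_mk.aemeasurable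

/-- Law of the `M × M` Rayleigh fading channel (entry `k m` is the coefficient between user `k`
and base-station antenna `m`; row `k` is the channel of user `k`): i.i.d. `CN(0,1)` entries. -/
noncomputable def channelLaw (M : ℕ) : Measure (Fin M → Fin M → ℂ) :=
  Measure.pi fun _ => Measure.pi fun _ => cgauss

/-- A fading block in which each user has sent `β` pilots: the channel, and the noise at antenna
`m` of the base station when it receives pilot number `b` of user `k`. -/
abbrev Sample (M β : ℕ) : Type :=
  (Fin M → Fin M → ℂ) × (Fin β → Fin M → Fin M → ℂ)

/-- Channel and receiver noise are independent, all with i.i.d. `CN(0,1)` entries. -/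
noncomputable def blockLaw (M β : ℕ) : Measure (Sample M β) :=
  (channelLaw M).prod (Measure.pi fun _ => Measure.pi fun _ => Measure.pi fun _ => cgauss)

instance (M : ℕ) : IsProbabilityMeasure (channelLaw M) := by
  unfold channelLaw; infer_instance

instance (M β : ℕ) : IsProbabilityMeasure (blockLaw M β) := by
  unfold blockLaw; infer_instance

/-- The pilot signals received at the base station: by reciprocity, pilot `b` of user `k`, sent
with power `ρ`, reaches antenna `m` through the downlink coefficient between the two. -/
noncomputable def pilots (M β : ℕ) (ρ : ℝ) (ω : Sample M β) : Fin β → Fin M → Fin M → ℂ :=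
  fun b k m => (Real.sqrt ρ : ℂ) * ω.1 k m + ω.2 b k m

theorem measurable_pilots (M β : ℕ) (ρ : ℝ) : Measurable (pilots M β ρ) := by
  unfold pilots; fun_prop

/-- The MMSE estimate of the channel given all received pilots: the conditional expectation of
each channel coefficient. -/
noncomputable def mmse (M β : ℕ) (ρ : ℝ) (ω : Sample M β) : Fin M → Fin M → ℂ :=
  fun k m => condExp (MeasurableSpace.comap (pilots M β ρ) inferInstance) (blockLaw M β)
    (fun ω' : Sample M β => ω'.1 k m) ω

/-- The zero-forcing precoder for the channel matrix `A`: the columns of `A⁻¹`, each normalized to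
Euclidean norm one. Column `k` is the beam of user `k`, orthogonal to the rows `j ≠ k` of `A`. -/
noncomputable def zf {M : ℕ} (A : Matrix (Fin M) (Fin M) ℂ) : Matrix (Fin M) (Fin M) ℂ :=
  Matrix.of fun m k => A⁻¹ m k / (Real.sqrt (∑ i, ‖A⁻¹ i k‖ ^ 2) : ℂ)

/-- Power received by user `k` from the beam of user `j`, when the channel is `H`, the precoder is
`V`, and the total power `P` is split equally over the `M` beams. -/
noncomputable def beamPower {M : ℕ} (P : ℝ) (H V : Matrix (Fin M) (Fin M) ℂ) (k j : Fin M) : ℝ :=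
  P / M * ‖(H * V) k j‖ ^ 2

/-- Instantaneous rate of user `k` (interference treated as noise), with unit noise power,
inter-beam interference from the other beams, and an extra interference of power `ι`. -/
noncomputable def instRate {M : ℕ} (P ι : ℝ) (H V : Matrix (Fin M) (Fin M) ℂ) (k : Fin M) : ℝ :=
  Real.log (1 + beamPower P H V k k /
    (1 + (∑ j ∈ Finset.univ.erase k, beamPower P H V k j) + ι))

/-- Instantaneous rate of user `k` with perfect channel knowledge at the base station, where there
is no inter-beam interference. -/
noncomputable def genieRate {M : ℕ} (P : ℝ) (k : Fin M) (H : Fin M → Fin M → ℂ) : ℝ :=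
  Real.log (1 + beamPower P (Matrix.of H) (zf (Matrix.of H)) k k)

/-- Instantaneous rate of user `k` when the base station applies zero forcing to the MMSE channel
estimate obtained from `β` pilots of power `f * P` per user. -/
noncomputable def trainedRate {M : ℕ} (P f ι : ℝ) (β : ℕ) (k : Fin M) (ω : Sample M β) : ℝ :=
  instRate P ι (Matrix.of ω.1) (zf (Matrix.of (mmse M β (f * P) ω))) k

/-- Ergodic zero-forcing rate with perfect channel knowledge. -/
noncomputable def RZF {M : ℕ} (P : ℝ) (k : Fin M) : ℝ :=
  ∫ H, genieRate P k H ∂(channelLaw M)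

/-- Ergodic rate without inter-node interference after `τ` training symbols in total,
that is `τ / M` pilots per user. -/
noncomputable def RDATA {M : ℕ} (P f : ℝ) (k : Fin M) (τ : ℕ) : ℝ :=
  ∫ ω, trainedRate P f 0 (τ / M) k ω ∂(blockLaw M (τ / M))

/-- Ergodic rate with inter-node interference of power `α * f * P` after `τ` training symbols in
total. -/
noncomputable def RINI {M : ℕ} (P f α : ℝ) (k : Fin M) (τ : ℕ) : ℝ :=
  ∫ ω, trainedRate P f (α * f * P) (τ / M) k ω ∂(blockLaw M (τ / M))

/-- Spectral efficiency of continuously adaptive beamforming with `τ` training symbols in a block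
of `T` symbols. In each training cycle `j ≥ 2` a user sees one symbol without inter-node
interference (its own pilot slot) and `M - 1` symbols with it; nothing is sent in cycle `1`. -/
noncomputable def ARCAB {M : ℕ} (P f α : ℝ) (k : Fin M) (T τ : ℕ) : ℝ :=
  ((T : ℝ) - τ) / T * RDATA P f k τ +
    1 / T * ∑ j ∈ Finset.Icc 2 (τ / M),
      (RDATA P f k ((j - 1) * M) + ((M : ℝ) - 1) * RINI P f α k ((j - 1) * M))

/-- Spectral efficiency of the half-duplex counterpart. -/
noncomputable def ARHD {M : ℕ} (P f : ℝ) (k : Fin M) (T τ : ℕ) : ℝ :=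
  ((T : ℝ) - τ) / T * RDATA P f k τ

/-- The full-duplex gain at equal training length. -/
noncomputable def ARG {M : ℕ} (P f α : ℝ) (k : Fin M) (T τ : ℕ) : ℝ :=
  ARCAB P f α k T τ - ARHD P f k T τ

/-- The rate loss caused by inter-node interference alone. -/
noncomputable def dRINI (M : ℕ) (P f α : ℝ) : ℝ :=
  Real.log ((1 + α * f * P) / (1 + α * f * P / (1 + P / M)))

end CAB

/-! The post-training terms cancel in the gain, which is `1/T` times a sum over cycles `j ≥ 2` of
rates obtained with `β = j - 1` pilots per user (`ARG_eq`). Everything rests on a lower bound for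
each such rate.

Signal. The beam of user `k` is, up to a phase, the normalized cofactor column of the estimate,
which ignores row `k`. Given the other rows and the noise it is a fixed unit vector, so `h_k v̂_k`
is exactly `CN(0,1)`, as with perfect knowledge (`identDistrib_genie`, `identDistrib_trained`). This
uses that the MMSE estimate is linear (`mmse_ae_eq_linEst`) and almost surely nonsingular
(`ae_det_ne_zero`).

Interference. The estimated row `k` is orthogonal to beam `j ≠ k`, so only the estimation error
leaks. Its mean square is `M / (β f P)`, and interference of power `I` costs at most `I` in the
logarithm: the rate is at least the scalar Rayleigh rate with INI minus `M / (β f)`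
(`ergodicRate_ge_rayleighRate`).

INI. The INI loss is concave in the signal power, so Jensen at the mean `P / M` bounds it by `dRINI`
(`rayleighRate_ge`).

Summed over cycles, the errors `1 / β` give a harmonic sum of order `log T`; after division by `T`,
this and the missing first cycle are `o(1/√T)`. Positivity and monotonicity in `α` come from
pointwise properties of the rate, strict because the signal power is almost surely positive. -/

namespace CAB

/-! ### Resampling one coordinate of a product measure. -/

section Resampling

variable {ι : Type*} [Fintype ι] [DecidableEq ι] {α : ι → Type*} [∀ i, MeasurableSpace (α i)]

/-- Replacing one coordinate of a product measure by an independent copy does not change the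
law. -/
theorem measurePreserving_update (μ : ∀ i, Measure (α i)) [∀ i, IsProbabilityMeasure (μ i)]
    (k : ι) :
    MeasurePreserving (fun p : (∀ i, α i) × α k => Function.update p.1 k p.2)
      ((Measure.pi μ).prod (μ k)) (Measure.pi μ) := by
  have hm : Measurable (fun p : (∀ i, α i) × α k => Function.update p.1 k p.2) := by
    refine measurable_pi_iff.2 fun i => ?_
    by_cases h : i = k
    · subst h; simpa using measurable_snd
    · simpa [Function.update_of_ne h, Function.comp_def] using
        (measurable_pi_apply i).comp (measurable_fst (α := ∀ i, α i) (β := α k))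
  refine ⟨hm, (Measure.pi_eq fun s hs => ?_).symm⟩
  rw [Measure.map_apply hm (MeasurableSet.univ_pi hs)]
  have : (fun p : (∀ i, α i) × α k => Function.update p.1 k p.2) ⁻¹' (Set.univ.pi s) =
      (Set.univ.pi (Function.update s k Set.univ)) ×ˢ (s k) := by
    ext p
    simp only [Set.mem_preimage, Set.mem_pi, Set.mem_univ, forall_const, Set.mem_prod]
    constructor
    · intro h
      refine ⟨fun i => ?_, by simpa using h k⟩
      by_cases hi : i = k
      · subst hi; simp
      · simpa [Function.update_of_ne hi] using h i
    · rintro ⟨h1, h2⟩ i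
      by_cases hi : i = k
      · subst hi; simpa using h2
      · simpa [Function.update_of_ne hi] using h1 i
  rw [this, Measure.prod_prod, Measure.pi_pi, ← Finset.prod_erase_mul _ _ (Finset.mem_univ k),
    ← Finset.prod_erase_mul _ (fun i => μ i (s i)) (Finset.mem_univ k)]
  simp only [Function.update_self, measure_univ, mul_one]
  congr 1
  refine Finset.prod_congr rfl fun i hi => ?_
  rw [Function.update_of_ne (Finset.ne_of_mem_erase hi)]

/-- Reduces a null-set claim to a single random coordinate, all others being frozen. -/
theorem ae_pi_of_ae_ae_update {μ : ∀ i, Measure (α i)} [∀ i, IsProbabilityMeasure (μ i)]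
    (k : ι) {p : (∀ i, α i) → Prop} (hp : MeasurableSet {x | p x})
    (h : ∀ᵐ x ∂Measure.pi μ, ∀ᵐ y ∂μ k, p (Function.update x k y)) :
    ∀ᵐ x ∂Measure.pi μ, p x := by
  have hu := measurePreserving_update μ k
  rw [← hu.map_eq, ae_map_iff hu.measurable.aemeasurable hp]
  exact (Measure.ae_prod_iff_ae_ae (hu.measurable hp)).2 h

theorem lintegral_pi_update (μ : ∀ i, Measure (α i)) [∀ i, IsProbabilityMeasure (μ i)]
    (k : ι) {φ : (∀ i, α i) → ENNReal} (hφ : Measurable φ) :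
    ∫⁻ x, φ x ∂Measure.pi μ = ∫⁻ x, ∫⁻ y, φ (Function.update x k y) ∂μ k ∂Measure.pi μ := by
  have hu := measurePreserving_update μ k
  rw [← hu.lintegral_comp hφ]
  exact lintegral_prod _ (hφ.comp hu.measurable).aemeasurable

end Resampling

/-! ### The complex Gaussian law. -/

section Gaussian

theorem charFunDual_gaussianReal (v : NNReal) (L : StrongDual ℝ ℝ) :
    charFunDual (gaussianReal 0 v) L = Complex.exp (-(v * (L 1) ^ 2 / 2 : ℝ)) := by
  have h : L = (L 1) • (ContinuousLinearMap.id ℝ ℝ) := by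
    ext
    simp
  generalize L 1 = t at h
  subst h
  have := charFun_gaussianReal (μ := 0) (v := v) t
  rw [charFun_apply_real] at this
  simp only [charFunDual_apply, smul_apply, ContinuousLinearMap.id_apply,
    smul_eq_mul, Complex.ofReal_mul]
  rw [this]
  congr 1
  push_cast
  ring

theorem charFunDual_cgauss (L : StrongDual ℝ ℂ) :
    charFunDual cgauss L = Complex.exp (-((L 1) ^ 2 + (L Complex.I) ^ 2 : ℝ) / 4) := by
  have : cgauss = ((gaussianReal 0 (1 / 2)).prod (gaussianReal 0 (1 / 2))).map
      (Complex.equivRealProdCLM.symm : ℝ × ℝ →L[ℝ] ℂ) := by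
    unfold cgauss
    congr 1
  rw [this, charFunDual_map, charFunDual_prod, charFunDual_gaussianReal,
    charFunDual_gaussianReal, ← Complex.exp_add]
  have h1 : Complex.equivRealProdCLM.symm ((1 : ℝ), (0 : ℝ)) = 1 := by
    apply Complex.ext <;> simp
  have h2 : Complex.equivRealProdCLM.symm ((0 : ℝ), (1 : ℝ)) = Complex.I := by
    apply Complex.ext <;> simp
  simp only [ContinuousLinearMap.comp_apply, ContinuousLinearMap.inl_apply,
    ContinuousLinearMap.inr_apply, ContinuousLinearEquiv.coe_coe, h1, h2]
  congr 1
  push_cast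
  ring

/-- Circular symmetry: multiplication by `u` is a rotation scaled by `‖u‖`, and the quadratic form
in the characteristic function of `cgauss` is rotation invariant. -/
theorem sq_apply_mul_add_sq (L : StrongDual ℝ ℂ) (u : ℂ) :
    L u ^ 2 + L (Complex.I * u) ^ 2 = ‖u‖ ^ 2 * (L 1 ^ 2 + L Complex.I ^ 2) := by
  have h : ∀ z : ℂ, L z = z.re * L 1 + z.im * L Complex.I := fun z => by
    conv_lhs => rw [← Complex.re_add_im z]
    rw [map_add, ← mul_one (z.re : ℂ), ← Complex.real_smul, ← Complex.real_smul, map_smul,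
      map_smul]
    simp
  rw [h u, h (Complex.I * u), Complex.sq_norm, Complex.normSq_apply]
  simp
  ring

/-- A unit-norm linear combination of i.i.d. `CN(0,1)` variables is again `CN(0,1)`. -/
theorem map_sum_mul_pi_cgauss {ι : Type*} [Fintype ι] (u : ι → ℂ) (hu : ∑ i, ‖u i‖ ^ 2 = 1) :
    (Measure.pi fun _ : ι => cgauss).map (fun x => ∑ i, x i * u i) = cgauss := by
  classical
  let A : (ι → ℂ) →L[ℝ] ℂ := ∑ i, ContinuousLinearMap.mul ℝ ℂ (u i) ∘L
    ContinuousLinearMap.proj i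
  have hA : (fun x : ι → ℂ => ∑ i, x i * u i) = A := by
    ext x; simp [A, mul_comm]
  rw [hA]
  have : IsProbabilityMeasure ((Measure.pi fun _ : ι => cgauss).map A) :=
    Measure.isProbabilityMeasure_map A.continuous.measurable.aemeasurable
  refine Measure.ext_of_charFunDual ?_
  ext L
  rw [charFunDual_map, charFunDual_pi, charFunDual_cgauss]
  simp_rw [charFunDual_cgauss]
  rw [← Complex.exp_sum]
  congr 1
  rw [← Finset.sum_div]
  congr 1
  have h1 : ∀ i (z : ℂ), A (Pi.single i z) = z * u i := fun i z => by
    simp [A, Pi.single_apply, mul_comm]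
  simp only [ContinuousLinearMap.comp_apply, ContinuousLinearMap.single_apply, h1, one_mul,
    sq_apply_mul_add_sq]
  rw [Finset.sum_neg_distrib, ← Complex.ofReal_sum, ← Finset.sum_mul, hu, one_mul]

theorem integrable_norm_sq_cgauss : Integrable (fun z : ℂ => ‖z‖ ^ 2) cgauss := by
  unfold cgauss
  rw [integrable_map_measure (by fun_prop) measurable_mk.aemeasurable]
  have h : Integrable (fun x : ℝ => x ^ 2) (gaussianReal 0 (1 / 2)) :=
    (memLp_id_gaussianReal 2).integrable_sq
  refine ((h.comp_fst _).add (h.comp_snd _)).congr (.of_forall fun p => ?_)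
  simp [Complex.sq_norm, Complex.normSq_apply, ← sq]

theorem integral_norm_sq_cgauss : ∫ z, ‖z‖ ^ 2 ∂cgauss = 1 := by
  unfold cgauss
  rw [integral_map measurable_mk.aemeasurable (by fun_prop)]
  have h : Integrable (fun x : ℝ => x ^ 2) (gaussianReal 0 (1 / 2)) :=
    (memLp_id_gaussianReal 2).integrable_sq
  have hv : ∫ x, x ^ 2 ∂(gaussianReal 0 (1 / 2)) = 1 / 2 := by
    have := variance_fun_id_gaussianReal (μ := 0) (v := 1 / 2)
    rw [variance_of_integral_eq_zero (by fun_prop) (by simp)] at this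
    simpa using this
  have : ∀ p : ℝ × ℝ, ‖(⟨p.1, p.2⟩ : ℂ)‖ ^ 2 = p.1 ^ 2 + p.2 ^ 2 := fun p => by
    simp [Complex.sq_norm, Complex.normSq_apply, ← sq]
  simp_rw [this]
  rw [integral_add (h.comp_fst _) (h.comp_snd _),
    integral_fun_fst (f := fun x : ℝ => x ^ 2), integral_fun_snd (f := fun x : ℝ => x ^ 2), hv]
  norm_num

instance : NullSingletonClass cgauss where
  measure_singleton z := by
    unfold cgauss
    rw [Measure.map_apply measurable_mk (measurableSet_singleton z)]
    have : (fun p : ℝ × ℝ => (⟨p.1, p.2⟩ : ℂ)) ⁻¹' {z} = {z.re} ×ˢ {z.im} := by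
      ext p; simp [Complex.ext_iff, Prod.ext_iff]
    have := nullSingletonClass_gaussianReal (μ := 0) (v := 1 / 2) (by norm_num)
    rw [‹_ ⁻¹' _ = _›, Measure.prod_prod, measure_singleton, zero_mul]

end Gaussian

/-! ### Almost sure nonsingularity. -/

section Determinant

/-- Some `w k` is nonzero; with the other coordinates frozen, a single value of `x k` makes the sum
vanish, and `cgauss` has no atoms. -/
theorem ae_sum_mul_ne_zero {ι : Type*} [Fintype ι] {w : ι → ℂ} (hw : w ≠ 0) (c : ℂ) (hc : c ≠ 0)
    (B : ι → ℂ) :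
    ∀ᵐ x ∂(Measure.pi fun _ : ι => cgauss), ∑ i, (c * x i + B i) * w i ≠ 0 := by
  classical
  obtain ⟨k, hk⟩ := Function.ne_iff.1 hw
  have hms : MeasurableSet {x : ι → ℂ | ∑ i, (c * x i + B i) * w i ≠ 0} := by
    have : Measurable (fun x : ι → ℂ => ∑ i, (c * x i + B i) * w i) := by fun_prop
    exact this (measurableSet_singleton 0).compl
  refine ae_pi_of_ae_ae_update k hms (.of_forall fun x => ?_)
  set r := ∑ i ∈ Finset.univ.erase k, (c * x i + B i) * w i
  have : {(-r / w k - B k) / c}ᶜ ∈ ae cgauss := compl_mem_ae_iff.2 (measure_singleton _)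
  filter_upwards [this] with y hy h0
  refine hy ?_
  rw [← Finset.sum_erase_add _ _ (Finset.mem_univ k)] at h0
  have : ∑ i ∈ Finset.univ.erase k, (c * Function.update x k y i + B i) * w i = r :=
    Finset.sum_congr rfl fun i hi => by rw [Function.update_of_ne (Finset.ne_of_mem_erase hi)]
  rw [this, Function.update_self] at h0
  have hk' : w k ≠ 0 := hk
  rw [Set.mem_singleton_iff, eq_div_iff hc, eq_sub_iff_add_eq, eq_div_iff hk']
  linear_combination h0

theorem measurable_det {Ω ι : Type*} [Fintype ι] [DecidableEq ι] [MeasurableSpace Ω]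
    {A : Ω → Matrix ι ι ℂ} (hA : ∀ i j, Measurable fun ω => A ω i j) :
    Measurable fun ω => (A ω).det := by
  simp_rw [Matrix.det_apply]
  fun_prop

/-- An invertible affine image of the Rayleigh channel matrix is almost surely nonsingular. -/
theorem ae_det_ne_zero (M : ℕ) (c : ℂ) (hc : c ≠ 0) (B : Fin M → Fin M → ℂ) :
    ∀ᵐ H ∂channelLaw M, (Matrix.of fun i j => c * H i j + B i j).det ≠ 0 := by
  -- Interpolation from the identity matrix: the rows in `s` are already random, and they are
  -- released one at a time.
  suffices ∀ s : Finset (Fin M), ∀ᵐ H ∂channelLaw M, (Matrix.of fun i j =>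
      if i ∈ s then c * H i j + B i j else (1 : Matrix (Fin M) (Fin M) ℂ) i j).det ≠ 0 by
    simpa using this Finset.univ
  intro s
  induction s using Finset.induction_on with
  | empty =>
    refine .of_forall fun H => ?_
    have : (Matrix.of fun i j => (1 : Matrix (Fin M) (Fin M) ℂ) i j) = 1 := rfl
    simp [this]
  | insert k s hk ih =>
    have hms : ∀ t : Finset (Fin M), Measurable fun H : Fin M → Fin M → ℂ => (Matrix.of fun i j =>
        if i ∈ t then c * H i j + B i j else (1 : Matrix (Fin M) (Fin M) ℂ) i j).det := by
      intro t
      refine measurable_det fun i j => ?_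
      by_cases hi : i ∈ t
      · simp only [Matrix.of_apply, hi, if_true]; fun_prop
      · simp only [Matrix.of_apply, hi, if_false]; fun_prop
    refine ae_pi_of_ae_ae_update k (hms _ (measurableSet_singleton 0).compl) ?_
    filter_upwards [ih] with H hH
    set A : Matrix (Fin M) (Fin M) ℂ := Matrix.of fun i j =>
      if i ∈ s then c * H i j + B i j else (1 : Matrix (Fin M) (Fin M) ℂ) i j with hA
    -- Laplace expansion along row `k`: the determinant is linear in that row, with coefficients
    -- that do not depend on it.
    have hdet : ∀ x : Fin M → ℂ, (A.updateRow k x).det = ∑ m, x m * A.adjugate m k := by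
      intro x
      have h1 := Matrix.mul_adjugate (A.updateRow k x)
      have h2 := congrFun (congrFun h1 k) k
      rw [Matrix.mul_apply] at h2
      simp only [Matrix.smul_apply, Matrix.one_apply_eq, smul_eq_mul, mul_one] at h2
      rw [← h2]
      refine Finset.sum_congr rfl fun m _ => ?_
      rw [Matrix.adjugate_apply, Matrix.adjugate_apply]
      simp
    -- If all these cofactors vanished, the expansion would give `A.det = 0`.
    have hw : (fun m => A.adjugate m k) ≠ 0 := by
      intro h0
      apply hH
      have := hdet (A k)
      rw [Matrix.updateRow_eq_self] at this
      rw [this]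
      exact Finset.sum_eq_zero fun m _ => by rw [congrFun h0 m]; simp
    filter_upwards [ae_sum_mul_ne_zero hw c hc (B k)] with x hx
    convert hx
    rw [← hdet]
    congr 1
    ext i j
    by_cases hi : i = k
    · subst hi; simp
    · simp [hA, hi]

end Determinant

/-! ### The MMSE estimate is linear. -/

section Estimate

/-- The linear MMSE estimate: the sum of the pilots of each user, scaled. -/
noncomputable def linEst (M β : ℕ) (ρ : ℝ) (ω : Sample M β) : Fin M → Fin M → ℂ :=
  fun k m => (Real.sqrt ρ / (1 + β * ρ) : ℝ) * ∑ b, pilots M β ρ ω b k m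

/-- The exponent is a sum of squares of the coordinates of `L`, so any linear map whose transpose
preserves that sum preserves the law. -/
theorem charFunDual_blockLaw (M β : ℕ) (L : StrongDual ℝ (Sample M β)) :
    charFunDual (blockLaw M β) L = Complex.exp
      (-(((∑ k, ∑ m, (L (Pi.single k (Pi.single m 1), 0) ^ 2 +
            L (Pi.single k (Pi.single m Complex.I), 0) ^ 2)) +
          ∑ b, ∑ k, ∑ m, (L (0, Pi.single b (Pi.single k (Pi.single m 1))) ^ 2 +
            L (0, Pi.single b (Pi.single k (Pi.single m Complex.I))) ^ 2) : ℝ) : ℂ) / 4) := by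
  unfold blockLaw channelLaw
  rw [charFunDual_prod]
  simp_rw [charFunDual_pi, charFunDual_cgauss, ← Complex.exp_sum]
  rw [← Complex.exp_add]
  congr 1
  simp only [← Finset.sum_div, Finset.sum_neg_distrib, ← Complex.ofReal_sum]
  simp only [ContinuousLinearMap.comp_apply, ContinuousLinearMap.inl_apply,
    ContinuousLinearMap.inr_apply, ContinuousLinearMap.single_apply]
  push_cast
  ring

/-- The reflection of the sample space that fixes all pilots and negates the estimation error. -/
noncomputable def reflect (M β : ℕ) (ρ : ℝ) : Sample M β →L[ℝ] Sample M β :=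
  LinearMap.toContinuousLinearMap
    { toFun := fun ω => (fun k m => ω.1 k m - 2 * (ω.1 k m - linEst M β ρ ω k m),
        fun b k m => ω.2 b k m + 2 * (Real.sqrt ρ : ℂ) * (ω.1 k m - linEst M β ρ ω k m))
      map_add' := fun ω ω' => by
        ext <;> simp [linEst, pilots, Finset.sum_add_distrib, mul_add] <;> ring
      map_smul' := fun a ω => by
        have h : ∀ k m, linEst M β ρ (a • ω) k m = a * linEst M β ρ ω k m := fun k m => by
          simp only [linEst, pilots, Finset.mul_sum]
          refine Finset.sum_congr rfl fun b _ => ?_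
          simp
          ring
        ext <;> simp [h] <;> ring }

theorem reflect_apply (M β : ℕ) (ρ : ℝ) (ω : Sample M β) :
    reflect M β ρ ω = (fun k m => ω.1 k m - 2 * (ω.1 k m - linEst M β ρ ω k m),
      fun b k m => ω.2 b k m + 2 * (Real.sqrt ρ : ℂ) * (ω.1 k m - linEst M β ρ ω k m)) := rfl

theorem pilots_reflect (M β : ℕ) (ρ : ℝ) (ω : Sample M β) :
    pilots M β ρ (reflect M β ρ ω) = pilots M β ρ ω := by
  ext b k m
  simp only [pilots, reflect_apply]
  ring

theorem linEst_reflect (M β : ℕ) (ρ : ℝ) (ω : Sample M β) :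
    linEst M β ρ (reflect M β ρ ω) = linEst M β ρ ω := by
  unfold linEst
  rw [pilots_reflect]

theorem err_reflect (M β : ℕ) (ρ : ℝ) (ω : Sample M β) (k m : Fin M) :
    (reflect M β ρ ω).1 k m - linEst M β ρ (reflect M β ρ ω) k m =
      -(ω.1 k m - linEst M β ρ ω k m) := by
  rw [linEst_reflect, reflect_apply]
  ring

theorem reflect_channel_single (M β : ℕ) {ρ : ℝ} (hρ : 0 ≤ ρ) (k m : Fin M) (z : ℂ) :
    reflect M β ρ (Pi.single k (Pi.single m z), 0) =
      (1 - 2 / (1 + β * ρ) : ℝ) • (Pi.single k (Pi.single m z), 0) +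
        ∑ b, (2 * Real.sqrt ρ / (1 + β * ρ) : ℝ) •
          (0, Pi.single b (Pi.single k (Pi.single m z))) := by
  have h1 : (1 + β * ρ : ℂ) ≠ 0 := by
    have : (1 + β * ρ : ℝ) ≠ 0 := by positivity
    exact_mod_cast this
  have hs : (Real.sqrt ρ : ℂ) * Real.sqrt ρ = ρ := by
    rw [← Complex.ofReal_mul, Real.mul_self_sqrt hρ]
  have he : ∀ k' m', linEst M β ρ (Pi.single k (Pi.single m z), 0) k' m' =
      β * ρ / (1 + β * ρ) * (Pi.single k (Pi.single m z) : Fin M → Fin M → ℂ) k' m' := by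
    intro k' m'
    simp only [linEst, pilots, Pi.zero_apply, add_zero, Finset.sum_const, Finset.card_univ,
      Fintype.card_fin, nsmul_eq_mul]
    push_cast
    rw [← hs]
    ring
  rw [reflect_apply]
  refine Prod.ext ?_ ?_
  · ext k' m'
    simp only [he, Prod.fst_add, Prod.fst_sum, Prod.smul_fst, Pi.add_apply, Pi.smul_apply,
      Pi.zero_apply, smul_zero, Finset.sum_const_zero, add_zero, Complex.real_smul]
    push_cast
    field_simp
    ring
  · ext b k' m'
    simp only [he, Prod.snd_add, Prod.snd_sum, Prod.smul_snd, Pi.add_apply, Pi.smul_apply,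
      smul_zero, zero_add, Complex.real_smul, Finset.sum_apply, Pi.zero_apply]
    rw [Finset.sum_eq_single b (fun b' _ hb => by simp [hb.symm]) (by simp)]
    simp only [Pi.single_eq_same]
    push_cast
    field_simp
    ring

theorem reflect_noise_single (M β : ℕ) (ρ : ℝ) (b : Fin β) (k m : Fin M) (z : ℂ) :
    reflect M β ρ (0, Pi.single b (Pi.single k (Pi.single m z))) =
      (2 * Real.sqrt ρ / (1 + β * ρ) : ℝ) • (Pi.single k (Pi.single m z), 0) +
        ((0, Pi.single b (Pi.single k (Pi.single m z))) -
          ∑ b', (2 * Real.sqrt ρ * (Real.sqrt ρ / (1 + β * ρ)) : ℝ) •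
            (0, Pi.single b' (Pi.single k (Pi.single m z)))) := by
  have he : ∀ k' m', linEst M β ρ (0, Pi.single b (Pi.single k (Pi.single m z))) k' m' =
      Real.sqrt ρ / (1 + β * ρ) *
        (Pi.single k (Pi.single m z) : Fin M → Fin M → ℂ) k' m' := by
    intro k' m'
    simp only [linEst, pilots, Pi.zero_apply, mul_zero, zero_add]
    rw [Finset.sum_eq_single b (fun b' _ hb => by simp [hb]) (by simp)]
    simp only [Pi.single_eq_same]
    push_cast
    ring
  rw [reflect_apply]
  refine Prod.ext ?_ ?_
  · ext k' m'
    simp only [he, Prod.fst_add, Prod.fst_sum, Prod.fst_sub, Prod.smul_fst, Pi.add_apply,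
      Pi.smul_apply, smul_zero, Finset.sum_const_zero, sub_zero, add_zero, Complex.real_smul,
      Pi.zero_apply]
    push_cast
    ring
  · ext b' k' m'
    simp only [he, Prod.snd_add, Prod.snd_sum, Prod.snd_sub, Prod.smul_snd, Pi.add_apply,
      Pi.sub_apply, Pi.smul_apply, smul_zero, zero_add, Complex.real_smul, Finset.sum_apply,
      Pi.zero_apply]
    rw [Finset.sum_eq_single b' (fun b'' _ hb => by simp [hb.symm]) (by simp)]
    simp only [Pi.single_eq_same]
    push_cast
    ring

/-- Per channel entry, `reflect` is the Householder reflection along `(1, -√ρ, …, -√ρ)`, a vector of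
squared length `1 + β * ρ`; hence it is orthogonal. -/
theorem reflection_sum_sq {β : ℕ} {ρ : ℝ} (hρ : 0 ≤ ρ) (a : ℝ) (n : Fin β → ℝ) :
    ((1 - 2 / (1 + β * ρ)) * a + ∑ b, 2 * Real.sqrt ρ / (1 + β * ρ) * n b) ^ 2 +
      ∑ b, (2 * Real.sqrt ρ / (1 + β * ρ) * a + (n b -
        ∑ b', 2 * Real.sqrt ρ * (Real.sqrt ρ / (1 + β * ρ)) * n b')) ^ 2 =
      a ^ 2 + ∑ b, n b ^ 2 := by
  have h1 : (1 + β * ρ : ℝ) ≠ 0 := by positivity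
  have hs := Real.mul_self_sqrt hρ
  set s := Real.sqrt ρ
  simp only [← Finset.mul_sum]
  set S := ∑ b, n b
  have : ∀ b, (2 * s / (1 + β * ρ) * a + (n b - 2 * s * (s / (1 + β * ρ)) * S)) ^ 2 =
      n b ^ 2 + 2 * (2 * s / (1 + β * ρ) * (a - s * S)) * n b +
        (2 * s / (1 + β * ρ) * (a - s * S)) ^ 2 := fun b => by ring
  simp_rw [this, Finset.sum_add_distrib, ← Finset.mul_sum, Finset.sum_const, Finset.card_univ,
    Fintype.card_fin, nsmul_eq_mul]
  change _ + (_ + _ * S + _) = _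
  have hr : ρ = s * s := hs.symm
  rw [hr] at h1 ⊢
  field_simp
  ring

theorem measurePreserving_reflect (M β : ℕ) {ρ : ℝ} (hρ : 0 ≤ ρ) :
    MeasurePreserving (reflect M β ρ) (blockLaw M β) (blockLaw M β) := by
  refine ⟨(reflect M β ρ).continuous.measurable, ?_⟩
  have : IsProbabilityMeasure ((blockLaw M β).map (reflect M β ρ)) :=
    Measure.isProbabilityMeasure_map (reflect M β ρ).continuous.measurable.aemeasurable
  refine Measure.ext_of_charFunDual ?_
  ext L
  rw [charFunDual_map, charFunDual_blockLaw, charFunDual_blockLaw]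
  congr 4
  have hswap : ∀ F : Fin β → Fin M → Fin M → ℝ,
      ∑ b, ∑ k, ∑ m, F b k m = ∑ k, ∑ m, ∑ b, F b k m := fun F => by
    rw [Finset.sum_comm]
    exact Finset.sum_congr rfl fun k _ => Finset.sum_comm
  simp only [hswap, ← Finset.sum_add_distrib]
  refine Finset.sum_congr rfl fun k _ => Finset.sum_congr rfl fun m _ => ?_
  have key : ∀ z : ℂ, (L ∘L reflect M β ρ) (Pi.single k (Pi.single m z), 0) ^ 2 +
      ∑ b, (L ∘L reflect M β ρ) (0, Pi.single b (Pi.single k (Pi.single m z))) ^ 2 =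
      L (Pi.single k (Pi.single m z), 0) ^ 2 +
        ∑ b, L (0, Pi.single b (Pi.single k (Pi.single m z))) ^ 2 := by
    intro z
    refine Eq.trans ?_ (reflection_sum_sq hρ (L (Pi.single k (Pi.single m z), 0))
      fun b => L (0, Pi.single b (Pi.single k (Pi.single m z))))
    simp only [ContinuousLinearMap.comp_apply, reflect_channel_single M β hρ,
      reflect_noise_single, map_add, map_sum, map_sub, map_smul, smul_eq_mul]
  have k1 := key 1
  have k2 := key Complex.I
  simp only [Finset.sum_add_distrib]
  linarith

theorem measurable_linEst (M β : ℕ) (ρ : ℝ) : Measurable (linEst M β ρ) := by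
  unfold linEst pilots
  fun_prop

theorem integrable_cgauss : Integrable (fun z : ℂ => z) cgauss := by
  have : MemLp (fun z : ℂ => z) 2 cgauss :=
    (memLp_two_iff_integrable_sq_norm (by fun_prop)).2 integrable_norm_sq_cgauss
  exact this.integrable (by norm_num)

theorem measurePreserving_channel_entry {M β : ℕ} (k m : Fin M) :
    MeasurePreserving (fun ω : Sample M β => ω.1 k m) (blockLaw M β) cgauss :=
  (measurePreserving_eval (fun _ => cgauss) m).comp
    ((measurePreserving_eval (fun _ => Measure.pi fun _ => cgauss) k).comp
      (measurePreserving_fst (μ := channelLaw M)))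

theorem measurePreserving_noise_entry {M β : ℕ} (b : Fin β) (k m : Fin M) :
    MeasurePreserving (fun ω : Sample M β => ω.2 b k m) (blockLaw M β) cgauss :=
  (measurePreserving_eval (fun _ => cgauss) m).comp
    ((measurePreserving_eval (fun _ => Measure.pi fun _ => cgauss) k).comp
      ((measurePreserving_eval (fun _ => Measure.pi fun _ => Measure.pi fun _ => cgauss) b).comp
        (measurePreserving_snd (μ := channelLaw M))))

theorem integrable_channel_entry {M β : ℕ} (k m : Fin M) :
    Integrable (fun ω : Sample M β => ω.1 k m) (blockLaw M β) :=
  (measurePreserving_channel_entry k m).integrable_comp_of_integrable integrable_cgauss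

theorem integrable_linEst {M β : ℕ} (ρ : ℝ) (k m : Fin M) :
    Integrable (fun ω : Sample M β => linEst M β ρ ω k m) (blockLaw M β) := by
  refine Integrable.const_mul (integrable_finsetSum _ fun b _ => ?_) _
  exact ((integrable_channel_entry k m).const_mul _).add
    ((measurePreserving_noise_entry b k m).integrable_comp_of_integrable integrable_cgauss)

/-- For jointly Gaussian channel and pilots the MMSE estimate is the linear one. -/
theorem mmse_ae_eq_linEst (M β : ℕ) {ρ : ℝ} (hρ : 0 ≤ ρ) :
    mmse M β ρ =ᵐ[blockLaw M β] linEst M β ρ := by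
  have key : ∀ k m : Fin M, ∀ᵐ ω ∂blockLaw M β, mmse M β ρ ω k m = linEst M β ρ ω k m := by
    intro k m
    have hle : MeasurableSpace.comap (pilots M β ρ) inferInstance ≤
        (inferInstance : MeasurableSpace (Sample M β)) := (measurable_pilots M β ρ).comap_le
    have h := ae_eq_condExp_of_forall_setIntegral_eq (μ := blockLaw M β) hle
      (f := fun ω : Sample M β => ω.1 k m) (g := fun ω => linEst M β ρ ω k m)
      (integrable_channel_entry k m) (fun s _ _ => (integrable_linEst ρ k m).integrableOn) ?_ ?_
    · filter_upwards [h] with ω hω using hω.symm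
    · rintro s ⟨t, ht, rfl⟩ -
      have hE : Integrable (fun ω : Sample M β => ω.1 k m - linEst M β ρ ω k m) (blockLaw M β) :=
        (integrable_channel_entry k m).sub (integrable_linEst ρ k m)
      have hR := measurePreserving_reflect M β hρ
      have hms : MeasurableSet (pilots M β ρ ⁻¹' t) := measurable_pilots M β ρ ht
      -- The reflection preserves the law and every event determined by the pilots, and flips the
      -- sign of the error: the integral equals its own negative.
      have h0 : ∫ ω in pilots M β ρ ⁻¹' t, (ω.1 k m - linEst M β ρ ω k m) ∂blockLaw M β = 0 := by
        have h1 : ∫ ω in pilots M β ρ ⁻¹' t, (ω.1 k m - linEst M β ρ ω k m) ∂blockLaw M β =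
            -∫ ω in pilots M β ρ ⁻¹' t, (ω.1 k m - linEst M β ρ ω k m) ∂blockLaw M β := by
          conv_lhs => rw [← hR.map_eq]
          rw [setIntegral_map hms (by rw [hR.map_eq]; exact hE.aestronglyMeasurable)
            hR.measurable.aemeasurable, ← Set.preimage_comp, ← integral_neg]
          have : pilots M β ρ ∘ reflect M β ρ = pilots M β ρ := funext fun ω =>
            pilots_reflect M β ρ ω
          rw [this]
          simp_rw [err_reflect]
        exact self_eq_neg.1 h1
      rw [integral_sub (integrable_channel_entry k m).integrableOn
        (integrable_linEst ρ k m).integrableOn, sub_eq_zero] at h0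
      exact h0.symm
    · have : Measurable[MeasurableSpace.comap (pilots M β ρ) inferInstance]
          (fun ω => linEst M β ρ ω k m) := by
        have hg : Measurable (fun y : Fin β → Fin M → Fin M → ℂ =>
            ((Real.sqrt ρ / (1 + β * ρ) : ℝ) : ℂ) * ∑ b, y b k m) := by fun_prop
        exact hg.comp (comap_measurable _)
      exact this.stronglyMeasurable.aestronglyMeasurable
  filter_upwards [ae_all_iff.2 fun k => ae_all_iff.2 fun m => key k m] with ω hω
  ext k m
  exact hω k m

theorem measurable_mmse (M β : ℕ) (ρ : ℝ) : Measurable (mmse M β ρ) := by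
  refine measurable_pi_iff.2 fun k => measurable_pi_iff.2 fun m => ?_
  exact (stronglyMeasurable_condExp.mono (measurable_pilots M β ρ).comap_le).measurable

end Estimate

/-! ### Zero-forcing beams and cofactors. -/

section Beams

variable {M : ℕ}

theorem norm_sum_mul_sq_le {ι : Type*} [Fintype ι] (x y : ι → ℂ) (hy : ∑ i, ‖y i‖ ^ 2 ≤ 1) :
    ‖∑ i, x i * y i‖ ^ 2 ≤ ∑ i, ‖x i‖ ^ 2 := by
  have h1 : ‖∑ i, x i * y i‖ ≤ ∑ i, ‖x i‖ * ‖y i‖ :=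
    (norm_sum_le _ _).trans_eq (Finset.sum_congr rfl fun i _ => norm_mul _ _)
  calc ‖∑ i, x i * y i‖ ^ 2 ≤ (∑ i, ‖x i‖ * ‖y i‖) ^ 2 := by gcongr
    _ ≤ (∑ i, ‖x i‖ ^ 2) * ∑ i, ‖y i‖ ^ 2 := Finset.sum_mul_sq_le_sq_mul_sq _ _ _
    _ ≤ (∑ i, ‖x i‖ ^ 2) * 1 := by gcongr
    _ = _ := mul_one _

/-- The right side stays an unreduced quotient so as to cover `y = 0`, where it is `0 / 0 = 0`. -/
theorem sum_norm_div_sqrt_sq {ι : Type*} [Fintype ι] (y : ι → ℂ) :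
    ∑ i, ‖y i / (Real.sqrt (∑ j, ‖y j‖ ^ 2) : ℂ)‖ ^ 2 =
      (∑ j, ‖y j‖ ^ 2) / ∑ j, ‖y j‖ ^ 2 := by
  simp_rw [norm_div, div_pow, Complex.norm_real, Real.norm_eq_abs, sq_abs,
    Real.sq_sqrt (Finset.sum_nonneg fun j _ => sq_nonneg ‖y j‖), ← Finset.sum_div]

/-- Only an inequality, since for singular `A` the inverse, and so the beam, is `0` by convention.
-/
theorem sum_norm_sq_zf_le_one (A : Matrix (Fin M) (Fin M) ℂ) (k : Fin M) :
    ∑ m, ‖zf A m k‖ ^ 2 ≤ 1 := by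
  simp only [zf, Matrix.of_apply]
  rw [sum_norm_div_sqrt_sq fun m => A⁻¹ m k]
  exact div_self_le_one _

/-- Column `k` of the cofactor matrix, normalized: it does not involve row `k` of `A`. -/
noncomputable def cofBeam (A : Matrix (Fin M) (Fin M) ℂ) (k m : Fin M) : ℂ :=
  A.adjugate m k / (Real.sqrt (∑ i, ‖A.adjugate i k‖ ^ 2) : ℂ)

theorem cofBeam_congr {A B : Matrix (Fin M) (Fin M) ℂ} {k : Fin M}
    (h : ∀ j, j ≠ k → ∀ m, A j m = B j m) : cofBeam A k = cofBeam B k := by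
  have : ∀ m, A.adjugate m k = B.adjugate m k := fun m => by
    rw [Matrix.adjugate_apply, Matrix.adjugate_apply]
    congr 1
    ext i j
    by_cases hi : i = k
    · subst hi; simp
    · simp [hi, h i hi]
  ext m
  simp only [cofBeam, this]

theorem sum_norm_sq_cofBeam {A : Matrix (Fin M) (Fin M) ℂ} (hA : A.det ≠ 0) (k : Fin M) :
    ∑ m, ‖cofBeam A k m‖ ^ 2 = 1 := by
  unfold cofBeam
  rw [sum_norm_div_sqrt_sq fun m => A.adjugate m k]
  refine div_self fun h0 => hA ?_
  have h1 := congrFun (congrFun (Matrix.mul_adjugate A) k) k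
  rw [Matrix.mul_apply] at h1
  simp only [Matrix.smul_apply, Matrix.one_apply_eq, smul_eq_mul, mul_one] at h1
  rw [← h1]
  refine Finset.sum_eq_zero fun m _ => ?_
  have := (Finset.sum_eq_zero_iff_of_nonneg fun j _ => sq_nonneg _).1 h0 m (Finset.mem_univ m)
  rw [norm_eq_zero.1 (pow_eq_zero_iff two_ne_zero |>.1 this), mul_zero]

/-- Column `k` of the inverse is the cofactor column divided by the determinant, so after
normalization the two differ by a phase. -/
theorem norm_sum_mul_zf {A : Matrix (Fin M) (Fin M) ℂ} (hA : A.det ≠ 0) (x : Fin M → ℂ)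
    (k : Fin M) : ‖∑ m, x m * zf A m k‖ = ‖∑ m, x m * cofBeam A k m‖ := by
  have hinv : ∀ i, A⁻¹ i k = A.det⁻¹ * A.adjugate i k := fun i => by
    rw [Matrix.inv_def, Ring.inverse_eq_inv', Matrix.smul_apply, smul_eq_mul]
  have hn : 0 < ‖A.det⁻¹‖ := norm_pos_iff.2 (inv_ne_zero hA)
  have hz : ∀ m, zf A m k = A.det⁻¹ / (‖A.det⁻¹‖ : ℝ) * cofBeam A k m := fun m => by
    simp only [zf, Matrix.of_apply, hinv, norm_mul, mul_pow, ← Finset.mul_sum, cofBeam]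
    rw [Real.sqrt_mul (sq_nonneg _), Real.sqrt_sq hn.le]
    push_cast
    rw [mul_div_mul_comm]
  simp_rw [hz]
  have : ∀ m, x m * (A.det⁻¹ / (‖A.det⁻¹‖ : ℝ) * cofBeam A k m) =
      A.det⁻¹ / (‖A.det⁻¹‖ : ℝ) * (x m * cofBeam A k m) := fun m => by ring
  simp_rw [this, ← Finset.mul_sum]
  rw [norm_mul, norm_div, Complex.norm_real, norm_norm, div_self hn.ne', one_mul]

theorem sum_row_mul_zf_eq_zero {A : Matrix (Fin M) (Fin M) ℂ} (hA : A.det ≠ 0) {k j : Fin M}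
    (hkj : k ≠ j) : ∑ m, A k m * zf A m j = 0 := by
  have h1 := congrFun (congrFun (Matrix.mul_nonsing_inv A (isUnit_iff_ne_zero.2 hA)) k) j
  rw [Matrix.mul_apply, Matrix.one_apply_ne hkj] at h1
  simp only [zf, Matrix.of_apply]
  simp_rw [← mul_div_assoc]
  rw [← Finset.sum_div, h1, zero_div]

theorem measurable_adjugate {Ω : Type*} [MeasurableSpace Ω] {A : Ω → Matrix (Fin M) (Fin M) ℂ}
    (hA : ∀ i j, Measurable fun ω => A ω i j) (i j : Fin M) :
    Measurable fun ω => (A ω).adjugate i j := by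
  simp_rw [Matrix.adjugate_apply]
  refine measurable_det fun a b => ?_
  by_cases h : a = j
  · subst h; simp
  · simpa [Matrix.updateRow_ne h] using hA a b

theorem measurable_cofBeam {Ω : Type*} [MeasurableSpace Ω] {A : Ω → Matrix (Fin M) (Fin M) ℂ}
    (hA : ∀ i j, Measurable fun ω => A ω i j) (k m : Fin M) :
    Measurable fun ω => cofBeam (A ω) k m := by
  have := measurable_adjugate hA
  unfold cofBeam
  fun_prop

theorem measurable_zf {Ω : Type*} [MeasurableSpace Ω] {A : Ω → Matrix (Fin M) (Fin M) ℂ}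
    (hA : ∀ i j, Measurable fun ω => A ω i j) (m k : Fin M) :
    Measurable fun ω => zf (A ω) m k := by
  have hinv : ∀ i j, Measurable fun ω => (A ω)⁻¹ i j := fun i j => by
    simp_rw [Matrix.inv_def, Ring.inverse_eq_inv', Matrix.smul_apply, smul_eq_mul]
    exact (measurable_det hA).inv.mul (measurable_adjugate hA i j)
  simp only [zf, Matrix.of_apply]
  exact (hinv m k).div (Complex.measurable_ofReal.comp (Real.continuous_sqrt.measurable.comp
    (Finset.measurable_sum _ fun i _ => (hinv i k).norm.pow_const 2)))

end Beams

/-! ### Laws of the signal and of the leakage. -/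

section Laws

variable {M : ℕ}

/-- A channel row seen through a unit-norm beam that does not depend on it is `CN(0,1)`. -/
theorem map_row_mul_channelLaw {u : (Fin M → Fin M → ℂ) → Fin M → ℂ} (hu : Measurable u)
    (k : Fin M) (hk : ∀ H x, u (Function.update H k x) = u H)
    (h1 : ∀ᵐ H ∂channelLaw M, ∑ m, ‖u H m‖ ^ 2 = 1) :
    (channelLaw M).map (fun H => ∑ m, H k m * u H m) = cgauss := by
  have hm : Measurable fun H : Fin M → Fin M → ℂ => ∑ m, H k m * u H m := by fun_prop
  refine Measure.ext_of_lintegral _ fun φ hφ => ?_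
  rw [lintegral_map hφ hm]
  unfold channelLaw at h1 ⊢
  refine (lintegral_pi_update _ k (hφ.comp hm)).trans ?_
  have : ∀ᵐ H ∂(Measure.pi fun _ : Fin M => Measure.pi fun _ : Fin M => cgauss),
      ∫⁻ x : Fin M → ℂ, φ (∑ m, (Function.update H k x : Fin M → Fin M → ℂ) k m *
        u (Function.update H k x) m) ∂(Measure.pi fun _ : Fin M => cgauss) = ∫⁻ z, φ z ∂cgauss := by
    filter_upwards [h1] with H hH
    simp_rw [hk, Function.update_self]
    rw [← lintegral_map (f := φ) (g := fun x : Fin M → ℂ => ∑ m, x m * u H m) hφ (by fun_prop),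
      map_sum_mul_pi_cgauss _ hH]
  simp only [Function.comp_apply]
  rw [lintegral_congr_ae this]
  simp

/-- The noise is integrated last: for each fixed `N` the channel-only statement applies. -/
theorem map_row_mul_blockLaw {β : ℕ} {u : Sample M β → Fin M → ℂ} (hu : Measurable u)
    (k : Fin M) (hk : ∀ H x N, u (Function.update H k x, N) = u (H, N))
    (h1 : ∀ N, ∀ᵐ H ∂channelLaw M, ∑ m, ‖u (H, N) m‖ ^ 2 = 1) :
    (blockLaw M β).map (fun ω => ∑ m, ω.1 k m * u ω m) = cgauss := by
  have hm : Measurable fun ω : Sample M β => ∑ m, ω.1 k m * u ω m := by fun_prop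
  refine Measure.ext_of_lintegral _ fun φ hφ => ?_
  rw [lintegral_map hφ hm]
  unfold blockLaw
  refine (lintegral_prod_symm _ (hφ.comp hm).aemeasurable).trans ?_
  have : ∀ N, ∫⁻ H, φ (∑ m, H k m * u (H, N) m) ∂channelLaw M = ∫⁻ z, φ z ∂cgauss := fun N => by
    have hN : Measurable fun H => u (H, N) := by fun_prop
    rw [← lintegral_map (f := φ) (g := fun H : Fin M → Fin M → ℂ => ∑ m, H k m * u (H, N) m) hφ
      (by fun_prop), map_row_mul_channelLaw hN k (fun H x => hk H x N) (h1 N)]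
  simp [this]

theorem ae_det_channel_ne_zero : ∀ᵐ H ∂channelLaw M, (Matrix.of H).det ≠ 0 := by
  have := ae_det_ne_zero M 1 one_ne_zero 0
  simpa using this

theorem linEst_eq {β : ℕ} (ρ : ℝ) (ω : Sample M β) (k m : Fin M) :
    linEst M β ρ ω k m = (Real.sqrt ρ / (1 + β * ρ) : ℝ) *
      (β * (Real.sqrt ρ : ℂ) * ω.1 k m + ∑ b, ω.2 b k m) := by
  simp only [linEst, pilots, Finset.sum_add_distrib, Finset.sum_const, Finset.card_univ,
    Fintype.card_fin, nsmul_eq_mul]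
  ring

theorem linEst_scale_ne_zero (β : ℕ) {ρ : ℝ} (hρ : 0 < ρ) :
    ((Real.sqrt ρ / (1 + β * ρ) : ℝ) : ℂ) ≠ 0 := by
  have := Real.sqrt_pos.2 hρ
  have : 0 < Real.sqrt ρ / (1 + β * ρ) := by positivity
  exact_mod_cast this.ne'

theorem ae_det_linEst_ne_zero {β : ℕ} (hβ : β ≠ 0) {ρ : ℝ} (hρ : 0 < ρ)
    (N : Fin β → Fin M → Fin M → ℂ) :
    ∀ᵐ H ∂channelLaw M, (Matrix.of (linEst M β ρ (H, N))).det ≠ 0 := by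
  have hs : (Real.sqrt ρ : ℂ) ≠ 0 := by exact_mod_cast (Real.sqrt_pos.2 hρ).ne'
  have hβ' : (β : ℂ) ≠ 0 := by exact_mod_cast hβ
  have := ae_det_ne_zero M ((Real.sqrt ρ / (1 + β * ρ) : ℝ) * (β * (Real.sqrt ρ : ℂ)))
    (mul_ne_zero (linEst_scale_ne_zero β hρ) (mul_ne_zero hβ' hs))
    (fun k m => (Real.sqrt ρ / (1 + β * ρ) : ℝ) * ∑ b, N b k m)
  filter_upwards [this] with H hH
  convert hH using 3
  ext k m
  rw [linEst_eq]
  ring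

theorem ae_blockLaw_det_linEst_ne_zero {β : ℕ} (hβ : β ≠ 0) {ρ : ℝ} (hρ : 0 < ρ) :
    ∀ᵐ ω ∂blockLaw M β, (Matrix.of (linEst M β ρ ω)).det ≠ 0 := by
  have hms : MeasurableSet {ω : Sample M β | (Matrix.of (linEst M β ρ ω)).det ≠ 0} := by
    have : Measurable fun ω : Sample M β => (Matrix.of (linEst M β ρ ω)).det :=
      measurable_det fun i j =>
        (measurable_pi_apply j).comp ((measurable_pi_apply i).comp (measurable_linEst M β ρ))
    exact this (measurableSet_singleton 0).compl
  unfold blockLaw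
  rw [Measure.ae_prod_iff_ae_ae hms, Measure.ae_ae_comm hms]
  exact .of_forall fun N => ae_det_linEst_ne_zero hβ hρ N

theorem identDistrib_genie (k : Fin M) :
    IdentDistrib (fun H : Fin M → Fin M → ℂ =>
      ‖(Matrix.of H * zf (Matrix.of H)) k k‖ ^ 2) (fun z : ℂ => ‖z‖ ^ 2)
      (channelLaw M) cgauss := by
  have hA : ∀ i j, Measurable fun H : Fin M → Fin M → ℂ => Matrix.of H i j := fun i j => by
    simp only [Matrix.of_apply]; fun_prop
  have hu : Measurable fun H : Fin M → Fin M → ℂ => cofBeam (Matrix.of H) k :=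
    measurable_pi_iff.2 fun m => measurable_cofBeam hA k m
  have hm : Measurable fun H : Fin M → Fin M → ℂ => ∑ m, H k m * cofBeam (Matrix.of H) k m := by
    fun_prop
  have hmap := map_row_mul_channelLaw hu k
    (fun H x => cofBeam_congr fun j hj m => by simp [Function.update_of_ne hj])
    (ae_det_channel_ne_zero.mono fun H hH => sum_norm_sq_cofBeam hH k)
  have hid : IdentDistrib (fun H : Fin M → Fin M → ℂ => ∑ m, H k m * cofBeam (Matrix.of H) k m)
      (fun z : ℂ => z) (channelLaw M) cgauss :=
    ⟨hm.aemeasurable, aemeasurable_id', by rw [hmap]; exact Measure.map_id.symm⟩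
  refine IdentDistrib.trans (.of_ae_eq ?_ ?_) (hid.comp (u := fun z : ℂ => ‖z‖ ^ 2) (by fun_prop))
  · have := measurable_zf hA
    simp only [Matrix.mul_apply]
    fun_prop
  · filter_upwards [ae_det_channel_ne_zero] with H hH
    simp only [Function.comp_apply, Matrix.mul_apply]
    rw [norm_sum_mul_zf hH]
    rfl

theorem measurable_mmse_entry (β : ℕ) (ρ : ℝ) (i j : Fin M) :
    Measurable fun ω => Matrix.of (mmse M β ρ ω) i j :=
  (measurable_pi_apply j).comp ((measurable_pi_apply i).comp (measurable_mmse M β ρ))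

/-- Row `j` of `linEst` involves only row `j` of the channel and the noise, so the beam of user `k`
does not see row `k` of the channel. Imperfect training thus leaves the law of the signal power
unchanged; at least one pilot is needed for the estimate to be nonsingular. -/
theorem identDistrib_trained {β : ℕ} (hβ : β ≠ 0) {ρ : ℝ} (hρ : 0 < ρ) (k : Fin M) :
    IdentDistrib (fun ω : Sample M β =>
      ‖(Matrix.of ω.1 * zf (Matrix.of (mmse M β ρ ω))) k k‖ ^ 2) (fun z : ℂ => ‖z‖ ^ 2)
      (blockLaw M β) cgauss := by
  have hA : ∀ i j, Measurable fun ω : Sample M β => Matrix.of (linEst M β ρ ω) i j := fun i j =>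
    (measurable_pi_apply j).comp ((measurable_pi_apply i).comp (measurable_linEst M β ρ))
  have hu : Measurable fun ω : Sample M β => cofBeam (Matrix.of (linEst M β ρ ω)) k :=
    measurable_pi_iff.2 fun m => measurable_cofBeam hA k m
  have hm : Measurable fun ω : Sample M β =>
      ∑ m, ω.1 k m * cofBeam (Matrix.of (linEst M β ρ ω)) k m := by
    fun_prop
  have hmap := map_row_mul_blockLaw hu k
    (fun H x N => cofBeam_congr fun j hj m => by simp [linEst_eq, Function.update_of_ne hj])
    (fun N => (ae_det_linEst_ne_zero hβ hρ N).mono fun H hH => sum_norm_sq_cofBeam hH k)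
  have hid : IdentDistrib (fun ω : Sample M β =>
      ∑ m, ω.1 k m * cofBeam (Matrix.of (linEst M β ρ ω)) k m)
      (fun z : ℂ => z) (blockLaw M β) cgauss :=
    ⟨hm.aemeasurable, aemeasurable_id', by rw [hmap]; exact Measure.map_id.symm⟩
  refine IdentDistrib.trans (.of_ae_eq ?_ ?_) (hid.comp (u := fun z : ℂ => ‖z‖ ^ 2) (by fun_prop))
  · have := measurable_zf (measurable_mmse_entry (M := M) β ρ)
    simp only [Matrix.mul_apply, Matrix.of_apply]
    fun_prop
  · filter_upwards [mmse_ae_eq_linEst M β hρ.le, ae_blockLaw_det_linEst_ne_zero hβ hρ]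
      with ω h1 h2
    simp only [Function.comp_apply, Matrix.mul_apply]
    rw [h1, norm_sum_mul_zf h2]
    rfl

/-- Squared error of the unbiased channel estimate of user `k`. -/
noncomputable def sqErr (M β : ℕ) (ρ : ℝ) (k : Fin M) (ω : Sample M β) : ℝ :=
  ∑ m, ‖(∑ b, ω.2 b k m) / (β * (Real.sqrt ρ : ℂ))‖ ^ 2

/-- The true row is the unbiased estimate minus the averaged noise, and beam `j` annihilates the
estimate; Cauchy–Schwarz bounds the rest. -/
theorem ae_norm_sq_cross_le {β : ℕ} (hβ : β ≠ 0) {ρ : ℝ} (hρ : 0 < ρ) (k : Fin M) :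
    ∀ᵐ ω ∂blockLaw M β, ∀ j, j ≠ k →
      ‖(Matrix.of ω.1 * zf (Matrix.of (mmse M β ρ ω))) k j‖ ^ 2 ≤ sqErr M β ρ k ω := by
  filter_upwards [mmse_ae_eq_linEst M β hρ.le, ae_blockLaw_det_linEst_ne_zero hβ hρ]
    with ω h1 h2 j hj
  rw [h1, Matrix.mul_apply]
  have h0 := sum_row_mul_zf_eq_zero h2 hj.symm
  have hs : (Real.sqrt ρ : ℂ) ≠ 0 := by exact_mod_cast (Real.sqrt_pos.2 hρ).ne'
  have hβ' : (β : ℂ) ≠ 0 := by exact_mod_cast hβ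
  have hd : (β * (Real.sqrt ρ : ℂ)) ≠ 0 := mul_ne_zero hβ' hs
  set V := zf (Matrix.of (linEst M β ρ ω)) with hV
  have h3 : ∑ m, (β * (Real.sqrt ρ : ℂ) * ω.1 k m + ∑ b, ω.2 b k m) * V m j = 0 := by
    simp only [Matrix.of_apply, linEst_eq, mul_assoc, ← Finset.mul_sum] at h0
    simpa [mul_assoc] using (mul_eq_zero.1 h0).resolve_left (linEst_scale_ne_zero β hρ)
  have h4 : ∑ m, (Matrix.of ω.1) k m * V m j =
      -∑ m, (∑ b, ω.2 b k m) / (β * (Real.sqrt ρ : ℂ)) * V m j := by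
    rw [eq_neg_iff_add_eq_zero, ← Finset.sum_add_distrib]
    have : ∀ m, (Matrix.of ω.1) k m * V m j +
        (∑ b, ω.2 b k m) / (β * (Real.sqrt ρ : ℂ)) * V m j =
        (β * (Real.sqrt ρ : ℂ))⁻¹ *
          ((β * (Real.sqrt ρ : ℂ) * ω.1 k m + ∑ b, ω.2 b k m) * V m j) := fun m => by
      rw [Matrix.of_apply]
      field_simp
    simp_rw [this, ← Finset.mul_sum, h3, mul_zero]
  rw [h4, norm_neg]
  exact norm_sum_mul_sq_le _ _ (sum_norm_sq_zf_le_one _ _)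

theorem map_noise_entry {β : ℕ} (k m : Fin M) :
    (blockLaw M β).map (fun ω : Sample M β => fun b => ω.2 b k m) =
      Measure.pi fun _ : Fin β => cgauss := by
  have h1 : MeasurePreserving (fun N : Fin M → Fin M → ℂ => N k m)
      (Measure.pi fun _ => Measure.pi fun _ => cgauss) cgauss :=
    (measurePreserving_eval (fun _ => cgauss) m).comp
      (measurePreserving_eval (fun _ => Measure.pi fun _ => cgauss) k)
  exact ((measurePreserving_pi _ _ fun _ : Fin β => h1).comp
    (measurePreserving_snd (μ := channelLaw M))).map_eq

theorem integrable_and_integral_norm_sq_sum_noise {β : ℕ} (hβ : β ≠ 0) (k m : Fin M) :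
    Integrable (fun ω : Sample M β => ‖∑ b, ω.2 b k m‖ ^ 2) (blockLaw M β) ∧
      ∫ ω, ‖∑ b, ω.2 b k m‖ ^ 2 ∂blockLaw M β = β := by
  have hβ' : (0 : ℝ) < β := by exact_mod_cast Nat.pos_of_ne_zero hβ
  have hs : 0 < Real.sqrt β := Real.sqrt_pos.2 hβ'
  -- Scaled by `1/√β`, the noise sum is a unit-norm combination, hence `CN(0,1)`.
  have hu : ∑ _b : Fin β, ‖((Real.sqrt β)⁻¹ : ℂ)‖ ^ 2 = 1 := by
    simp only [norm_inv, Complex.norm_real, Real.norm_eq_abs, abs_of_pos hs, inv_pow,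
      Real.sq_sqrt hβ'.le]
    simp [hβ'.ne']
  have hmap : (blockLaw M β).map
      (fun ω : Sample M β => ∑ b, ω.2 b k m * ((Real.sqrt β)⁻¹ : ℂ)) = cgauss := by
    rw [← map_sum_mul_pi_cgauss _ hu, ← map_noise_entry k m, Measure.map_map] <;>
      first | rfl | fun_prop
  have hid : IdentDistrib (fun ω : Sample M β => ∑ b, ω.2 b k m * ((Real.sqrt β)⁻¹ : ℂ))
      (fun z : ℂ => z) (blockLaw M β) cgauss :=
    ⟨by fun_prop, aemeasurable_id', by rw [hmap]; exact Measure.map_id.symm⟩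
  have hid2 := hid.comp (u := fun z : ℂ => β * ‖z‖ ^ 2) (by fun_prop)
  have heq : (fun z : ℂ => β * ‖z‖ ^ 2) ∘
      (fun ω : Sample M β => ∑ b, ω.2 b k m * ((Real.sqrt β)⁻¹ : ℂ)) =
      fun ω => ‖∑ b, ω.2 b k m‖ ^ 2 := by
    ext ω
    simp only [Function.comp_apply, ← Finset.sum_mul, norm_mul, norm_inv, Complex.norm_real,
      Real.norm_eq_abs, abs_of_pos hs, mul_pow, inv_pow, Real.sq_sqrt hβ'.le]
    field_simp
  rw [heq] at hid2
  refine ⟨hid2.integrable_iff.2 (integrable_norm_sq_cgauss.const_mul _), ?_⟩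
  rw [hid2.integral_eq]
  simp only [Function.comp_apply]
  rw [integral_const_mul, integral_norm_sq_cgauss, mul_one]

theorem integrable_and_integral_sqErr {β : ℕ} (hβ : β ≠ 0) {ρ : ℝ} (hρ : 0 < ρ) (k : Fin M) :
    Integrable (sqErr M β ρ k) (blockLaw M β) ∧
      ∫ ω, sqErr M β ρ k ω ∂blockLaw M β = M / (β * ρ) := by
  have hβ' : (0 : ℝ) < β := by exact_mod_cast Nat.pos_of_ne_zero hβ
  have heq : sqErr M β ρ k = fun ω => ∑ m, (β ^ 2 * ρ)⁻¹ * ‖∑ b, ω.2 b k m‖ ^ 2 := by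
    ext ω
    refine Finset.sum_congr rfl fun m _ => ?_
    rw [norm_div, norm_mul, Complex.norm_real, Complex.norm_natCast, div_pow, mul_pow,
      Real.norm_eq_abs, sq_abs, Real.sq_sqrt hρ.le, div_eq_inv_mul]
  have h := fun m => integrable_and_integral_norm_sq_sum_noise (β := β) hβ k m
  rw [heq]
  refine ⟨integrable_finsetSum _ fun m _ => (h m).1.const_mul _, ?_⟩
  rw [integral_finsetSum _ fun m _ => (h m).1.const_mul _]
  simp_rw [integral_const_mul, (h _).2]
  simp only [Finset.sum_const, Finset.card_univ, Fintype.card_fin, nsmul_eq_mul]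
  field_simp

end Laws

/-! ### Logarithmic inequalities. -/

section Inequalities

/-- Interference `I` enlarges both total power and noise; the first only helps, and the second costs
`log ((1 + I + ι) / (1 + ι)) ≤ I`. -/
theorem log_one_add_div_sub_le {s I ι : ℝ} (hs : 0 ≤ s) (hI : 0 ≤ I) (hι : 0 ≤ ι) :
    Real.log (1 + s / (1 + ι)) - I ≤ Real.log (1 + s / (1 + I + ι)) := by
  have h1 : 1 + s / (1 + ι) = (1 + ι + s) / (1 + ι) := by field_simp
  have h2 : 1 + s / (1 + I + ι) = (1 + I + ι + s) / (1 + I + ι) := by field_simp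
  rw [h1, h2, Real.log_div (by positivity) (by positivity),
    Real.log_div (by positivity) (by positivity)]
  have h3 : Real.log (1 + ι + s) ≤ Real.log (1 + I + ι + s) :=
    Real.log_le_log (by positivity) (by linarith)
  have h4 : Real.log (1 + I + ι) - Real.log (1 + ι) ≤ I := by
    rw [← Real.log_div (by positivity) (by positivity)]
    refine (Real.log_le_sub_one_of_pos (by positivity)).trans ?_
    rw [sub_le_iff_le_add, div_le_iff₀ (by positivity)]
    nlinarith [mul_nonneg hI hι]
  linarith

/-- Tangent line at `p` of the convex function `s ↦ log (1 + s / (1 + ι)) - log (1 + s)`. -/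
theorem log_one_add_div_tangent {p ι s : ℝ} (hp : 0 ≤ p) (hι : 0 ≤ ι) (hs : 0 ≤ s) :
    Real.log (1 + s) - Real.log ((1 + ι) / (1 + ι / (1 + p))) -
      ι / (1 + p + ι) / (1 + p) * (s - p) ≤ Real.log (1 + s / (1 + ι)) := by
  -- The loss at `s` is `log (1 + ι) - log (1 + ι / (1 + s))`. This weight makes the mixture of `1`
  -- and `(1 + p) / (1 + s)` equal to the ratio of `1 + ι / (1 + s)` to its value at `s = p`, so
  -- concavity of `log` compares the two losses.
  set w := ι / (1 + p + ι) with hw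
  have hw0 : 0 ≤ w := by positivity
  have hw1 : w ≤ 1 := (div_le_one (by positivity)).2 (by linarith)
  have hc := strictConcaveOn_log_Ioi.concaveOn.2 (x := 1) (y := (1 + p) / (1 + s))
    (Set.mem_Ioi.2 one_pos) (Set.mem_Ioi.2 (by positivity)) (sub_nonneg.2 hw1) hw0 (by ring)
  simp only [smul_eq_mul, Real.log_one, mul_zero, zero_add, mul_one] at hc
  have hmix : 1 - w + w * ((1 + p) / (1 + s)) = (1 + ι / (1 + s)) / (1 + ι / (1 + p)) := by
    rw [hw]; field_simp; ring
  have hlog : Real.log (1 + s) - Real.log (1 + p) ≤ (s - p) / (1 + p) := by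
    rw [← Real.log_div (by positivity) (by positivity)]
    refine (Real.log_le_sub_one_of_pos (by positivity)).trans_eq ?_
    field_simp
    ring
  rw [hmix, Real.log_div (by positivity) (by positivity),
    Real.log_div (by positivity) (by positivity)] at hc
  have h1 : 1 + s / (1 + ι) = (1 + s) * (1 + ι / (1 + s)) / (1 + ι) := by
    field_simp
    ring
  rw [h1, Real.log_div (x := (1 + s) * (1 + ι / (1 + s))) (by positivity) (by positivity),
    Real.log_mul (by positivity) (by positivity), Real.log_div (by positivity) (by positivity)]
  have h2 := mul_le_mul_of_nonneg_left hlog hw0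
  have h3 : w / (1 + p) * (s - p) = w * ((s - p) / (1 + p)) := by ring
  rw [h3]
  linarith

theorem log_one_add_nonneg_le {s : ℝ} (hs : 0 ≤ s) :
    0 ≤ Real.log (1 + s) ∧ Real.log (1 + s) ≤ s :=
  ⟨Real.log_nonneg (by linarith), by
    have := Real.log_le_sub_one_of_pos (show 0 < 1 + s by linarith); linarith⟩

end Inequalities

/-! ### Ergodic rates and their lower bounds. -/

section Rates

variable {M : ℕ}

theorem beamPower_nonneg {P : ℝ} (hP : 0 ≤ P) (H V : Matrix (Fin M) (Fin M) ℂ) (k j : Fin M) :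
    0 ≤ beamPower P H V k j := by
  unfold beamPower; positivity

theorem interference_nonneg {P : ℝ} (hP : 0 ≤ P) (H V : Matrix (Fin M) (Fin M) ℂ) (k : Fin M) :
    0 ≤ ∑ j ∈ Finset.univ.erase k, beamPower P H V k j :=
  Finset.sum_nonneg fun j _ => beamPower_nonneg hP H V k j

theorem beamPower_zf_le {P : ℝ} (hP : 0 ≤ P) (H A : Matrix (Fin M) (Fin M) ℂ) (k j : Fin M) :
    beamPower P H (zf A) k j ≤ P / M * ∑ m, ‖H k m‖ ^ 2 := by
  unfold beamPower
  rw [Matrix.mul_apply]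
  gcongr
  exact norm_sum_mul_sq_le _ _ (sum_norm_sq_zf_le_one _ _)

theorem instRate_nonneg_le {P ι : ℝ} (hP : 0 ≤ P) (hι : 0 ≤ ι) (H V : Matrix (Fin M) (Fin M) ℂ)
    (k : Fin M) : 0 ≤ instRate P ι H V k ∧ instRate P ι H V k ≤ beamPower P H V k k := by
  have hS := beamPower_nonneg hP H V k k
  have hI := interference_nonneg hP H V k
  unfold instRate
  generalize beamPower P H V k k = S at *
  generalize ∑ j ∈ Finset.univ.erase k, beamPower P H V k j = I at *
  obtain ⟨h1, h2⟩ := log_one_add_nonneg_le (div_nonneg hS (by positivity : 0 ≤ 1 + I + ι))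
  exact ⟨h1, h2.trans (div_le_self hS (by linarith))⟩

theorem instRate_anti {P ι ι' : ℝ} (hP : 0 ≤ P) (hι : 0 ≤ ι) (h : ι ≤ ι')
    (H V : Matrix (Fin M) (Fin M) ℂ) (k : Fin M) : instRate P ι' H V k ≤ instRate P ι H V k := by
  have hS := beamPower_nonneg hP H V k k
  have hI := interference_nonneg hP H V k
  have hι' := hι.trans h
  unfold instRate
  generalize beamPower P H V k k = S at *
  generalize ∑ j ∈ Finset.univ.erase k, beamPower P H V k j = I at *
  gcongr

theorem instRate_strictAnti {P ι ι' : ℝ} (hP : 0 ≤ P) (hι : 0 ≤ ι) (h : ι < ι')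
    {H V : Matrix (Fin M) (Fin M) ℂ} {k : Fin M} (hS : 0 < beamPower P H V k k) :
    instRate P ι' H V k < instRate P ι H V k := by
  have hI := interference_nonneg hP H V k
  have hι' := hι.trans h.le
  unfold instRate
  generalize beamPower P H V k k = S at *
  generalize ∑ j ∈ Finset.univ.erase k, beamPower P H V k j = I at *
  gcongr

theorem instRate_pos {P ι : ℝ} (hP : 0 ≤ P) (hι : 0 ≤ ι)
    {H V : Matrix (Fin M) (Fin M) ℂ} {k : Fin M} (hS : 0 < beamPower P H V k k) :
    0 < instRate P ι H V k := by
  have hI := interference_nonneg hP H V k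
  unfold instRate
  generalize beamPower P H V k k = S at *
  generalize ∑ j ∈ Finset.univ.erase k, beamPower P H V k j = I at *
  refine Real.log_pos ?_
  have : 0 < S / (1 + I + ι) := by positivity
  linarith

theorem integrable_channel_row {β : ℕ} (k : Fin M) (c : ℝ) :
    Integrable (fun ω : Sample M β => c * ∑ m, ‖ω.1 k m‖ ^ 2) (blockLaw M β) :=
  (integrable_finsetSum _ fun m _ =>
    (measurePreserving_channel_entry k m).integrable_comp_of_integrable
      integrable_norm_sq_cgauss).const_mul c

/-- The rate is at most the signal power, which is at most `P / M * ‖h_k‖²` because beams have norm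
at most one; this needs no pilots and no invertibility. -/
theorem integrable_trainedRate {P : ℝ} (hP : 0 ≤ P) (f : ℝ) {ι : ℝ} (hι : 0 ≤ ι) (β : ℕ)
    (k : Fin M) : Integrable (trainedRate P f ι β k) (blockLaw M β) := by
  refine (integrable_channel_row k (P / M)).mono' ?_ (.of_forall fun ω => ?_)
  · have hz := measurable_zf (measurable_mmse_entry (M := M) β (f * P))
    have hb : ∀ j, Measurable fun ω : Sample M β =>
        beamPower P (Matrix.of ω.1) (zf (Matrix.of (mmse M β (f * P) ω))) k j := fun j => by
      simp only [beamPower, Matrix.mul_apply, Matrix.of_apply]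
      fun_prop
    unfold trainedRate instRate
    exact (Real.measurable_log.comp (measurable_const.add ((hb k).div
      ((measurable_const.add (Finset.measurable_sum _ fun j _ => hb j)).add
        measurable_const)))).aestronglyMeasurable
  · obtain ⟨h1, h2⟩ := instRate_nonneg_le hP hι (Matrix.of ω.1)
      (zf (Matrix.of (mmse M β (f * P) ω))) k
    rw [Real.norm_eq_abs, trainedRate, abs_of_nonneg h1]
    exact h2.trans (beamPower_zf_le hP _ _ k k)

/-- Ergodic rate of a scalar Rayleigh link with mean signal power `p` and noise power `1 + ι`. -/
noncomputable def rayleighRate (p ι : ℝ) : ℝ :=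
  ∫ z, Real.log (1 + p * ‖z‖ ^ 2 / (1 + ι)) ∂cgauss

theorem integrable_rayleigh {p ι : ℝ} (hp : 0 ≤ p) (hι : 0 ≤ ι) :
    Integrable (fun z : ℂ => Real.log (1 + p * ‖z‖ ^ 2 / (1 + ι))) cgauss := by
  refine (integrable_norm_sq_cgauss.const_mul p).mono'
    (Real.measurable_log.comp (by fun_prop)).aestronglyMeasurable (.of_forall fun z => ?_)
  obtain ⟨h1, h2⟩ := log_one_add_nonneg_le (by positivity : 0 ≤ p * ‖z‖ ^ 2 / (1 + ι))
  rw [Real.norm_eq_abs, abs_of_nonneg h1]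
  exact h2.trans (div_le_self (by positivity) (by linarith))

theorem ae_cgauss_norm_sq_pos : ∀ᵐ z ∂cgauss, 0 < ‖z‖ ^ 2 := by
  have : {(0 : ℂ)}ᶜ ∈ ae cgauss := compl_mem_ae_iff.2 (measure_singleton _)
  filter_upwards [this] with z hz
  have : 0 < ‖z‖ := norm_pos_iff.2 hz
  positivity

theorem integral_pos_of_ae_pos {Ω : Type*} [MeasurableSpace Ω] {μ : Measure Ω}
    [IsProbabilityMeasure μ] {g : Ω → ℝ} (hg : Integrable g μ) (h : ∀ᵐ ω ∂μ, 0 < g ω) :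
    0 < ∫ ω, g ω ∂μ := by
  have h0 : 0 ≤ᵐ[μ] g := h.mono fun ω hω => hω.le
  refine lt_of_le_of_ne (integral_nonneg_of_ae h0) fun heq => ?_
  have h1 := (integral_eq_zero_iff_of_nonneg_ae h0 hg).1 heq.symm
  have : ∀ᵐ _ω ∂μ, False := by
    filter_upwards [h, h1] with ω h2 h3
    exact h2.ne' h3
  exact this.exists.elim fun _ h => h

theorem rayleighRate_pos {p ι : ℝ} (hp : 0 < p) (hι : 0 ≤ ι) : 0 < rayleighRate p ι := by
  refine integral_pos_of_ae_pos (integrable_rayleigh hp.le hι) ?_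
  filter_upwards [ae_cgauss_norm_sq_pos] with z hz
  refine Real.log_pos ?_
  have : 0 < p * ‖z‖ ^ 2 / (1 + ι) := by positivity
  linarith

/-- Jensen: the signal power has mean `p`, so integrating the tangent at `p` kills its linear term.
-/
theorem rayleighRate_ge {p ι : ℝ} (hp : 0 ≤ p) (hι : 0 ≤ ι) :
    rayleighRate p 0 - Real.log ((1 + ι) / (1 + ι / (1 + p))) ≤ rayleighRate p ι := by
  set κ := ι / (1 + p + ι) / (1 + p)
  have h0 := integrable_rayleigh hp le_rfl
  have hlin : Integrable (fun z : ℂ => κ * (p * ‖z‖ ^ 2 - p)) cgauss :=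
    ((integrable_norm_sq_cgauss.const_mul p).sub (integrable_const p)).const_mul κ
  have hlin0 : ∫ z, κ * (p * ‖z‖ ^ 2 - p) ∂cgauss = 0 := by
    rw [integral_const_mul, integral_sub (integrable_norm_sq_cgauss.const_mul p)
      (integrable_const p), integral_const_mul, integral_norm_sq_cgauss]
    simp
  have := integral_mono ((h0.sub (integrable_const
    (Real.log ((1 + ι) / (1 + ι / (1 + p)))))).sub hlin) (integrable_rayleigh hp hι)
    fun z => by
      simpa using log_one_add_div_tangent hp hι (by positivity : 0 ≤ p * ‖z‖ ^ 2)
  rw [integral_sub' (h0.sub (integrable_const _)) hlin, hlin0,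
    integral_sub' h0 (integrable_const _)] at this
  simpa [rayleighRate] using this

theorem identDistrib_rayleigh {p ι : ℝ} {Ω : Type*} [MeasurableSpace Ω] {μ : Measure Ω}
    {g : Ω → ℝ} (h : IdentDistrib g (fun z : ℂ => ‖z‖ ^ 2) μ cgauss) :
    IdentDistrib (fun ω => Real.log (1 + p * g ω / (1 + ι)))
      (fun z : ℂ => Real.log (1 + p * ‖z‖ ^ 2 / (1 + ι))) μ cgauss :=
  h.comp (u := fun x : ℝ => Real.log (1 + p * x / (1 + ι))) (by fun_prop)

theorem integrable_genieRate {P : ℝ} (hP : 0 ≤ P) (k : Fin M) :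
    Integrable (genieRate P k) (channelLaw M) := by
  have := (identDistrib_rayleigh (p := P / M) (ι := 0) (identDistrib_genie k)).integrable_iff.2
    (integrable_rayleigh (by positivity) le_rfl)
  unfold genieRate beamPower
  simpa using this

/-- In particular the rate is the same for all users, which lets the error term be chosen
independently of `k`. -/
theorem RZF_eq_rayleighRate (P : ℝ) (k : Fin M) : RZF P k = rayleighRate (P / M) 0 := by
  have := (identDistrib_rayleigh (p := P / M) (ι := 0) (identDistrib_genie k)).integral_eq
  unfold RZF genieRate beamPower rayleighRate
  rw [← this]
  simp

theorem ae_beamPower_pos {P f : ℝ} (hP : 0 < P) (hf : 0 < f) {β : ℕ} (hβ : β ≠ 0) (k : Fin M) :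
    ∀ᵐ ω ∂blockLaw M β,
      0 < beamPower P (Matrix.of ω.1) (zf (Matrix.of (mmse M β (f * P) ω))) k k := by
  have hM : (0 : ℝ) < M := by exact_mod_cast k.pos
  have := (identDistrib_trained hβ (mul_pos hf hP) k).symm.ae_snd (p := fun x : ℝ => 0 < x)
    measurableSet_Ioi ae_cgauss_norm_sq_pos
  filter_upwards [this] with ω hω
  unfold beamPower
  positivity

/-- Ergodic rate after `β` pilots per user, with inter-node interference of power `ι`. -/
noncomputable def ergodicRate (P f ι : ℝ) (k : Fin M) (β : ℕ) : ℝ :=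
  ∫ ω, trainedRate P f ι β k ω ∂blockLaw M β

theorem ergodicRate_nonneg {P : ℝ} (hP : 0 ≤ P) (f : ℝ) {ι : ℝ} (hι : 0 ≤ ι) (k : Fin M)
    (β : ℕ) : 0 ≤ ergodicRate P f ι k β :=
  integral_nonneg fun _ => (instRate_nonneg_le hP hι _ _ k).1

theorem ergodicRate_pos {P f ι : ℝ} (hP : 0 < P) (hf : 0 < f) (hι : 0 ≤ ι) (k : Fin M)
    {β : ℕ} (hβ : β ≠ 0) : 0 < ergodicRate P f ι k β :=
  integral_pos_of_ae_pos (integrable_trainedRate hP.le f hι β k)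
    ((ae_beamPower_pos hP hf hβ k).mono fun _ hω => instRate_pos hP.le hι hω)

theorem ergodicRate_antitoneOn {P : ℝ} (hP : 0 ≤ P) (f : ℝ) (k : Fin M) (β : ℕ) :
    AntitoneOn (fun ι => ergodicRate P f ι k β) (Set.Ici 0) := fun _ hι _ hι' h =>
  integral_mono (integrable_trainedRate hP f hι' β k) (integrable_trainedRate hP f hι β k)
    fun _ => instRate_anti hP hι h _ _ k

theorem ergodicRate_strictAntiOn {P f : ℝ} (hP : 0 < P) (hf : 0 < f) (k : Fin M) {β : ℕ}
    (hβ : β ≠ 0) : StrictAntiOn (fun ι => ergodicRate P f ι k β) (Set.Ici 0) := by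
  intro ι hι ι' hι' h
  have h1 := integrable_trainedRate hP.le f hι β k
  have h2 := integrable_trainedRate hP.le f hι' β k
  have := integral_pos_of_ae_pos (h1.sub h2) ((ae_beamPower_pos hP hf hβ k).mono fun _ hω =>
    sub_pos.2 (instRate_strictAnti hP.le hι h hω))
  rw [integral_sub' h1 h2] at this
  exact sub_pos.1 this

theorem ergodicRate_ge_rayleighRate {P f ι : ℝ} (hP : 0 < P) (hf : 0 < f) (hι : 0 ≤ ι)
    (k : Fin M) {β : ℕ} (hβ : β ≠ 0) :
    rayleighRate (P / M) ι - M / (β * f) ≤ ergodicRate P f ι k β := by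
  have hM : (0 : ℝ) < M := by exact_mod_cast k.pos
  have hid := identDistrib_rayleigh (p := P / M) (ι := ι)
    (identDistrib_trained hβ (mul_pos hf hP) k)
  obtain ⟨herr, herr'⟩ := integrable_and_integral_sqErr hβ (mul_pos hf hP) k
  have hint := hid.integrable_iff.2 (integrable_rayleigh (by positivity) hι)
  have hle : ∀ᵐ ω ∂blockLaw M β, Real.log (1 + P / M *
      ‖(Matrix.of ω.1 * zf (Matrix.of (mmse M β (f * P) ω))) k k‖ ^ 2 / (1 + ι)) -
      P * sqErr M β (f * P) k ω ≤ trainedRate P f ι β k ω := by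
    filter_upwards [ae_norm_sq_cross_le hβ (mul_pos hf hP) k] with ω hω
    have hI0 := interference_nonneg hP.le (Matrix.of ω.1)
      (zf (Matrix.of (mmse M β (f * P) ω))) k
    have hI : ∑ j ∈ Finset.univ.erase k, beamPower P (Matrix.of ω.1)
        (zf (Matrix.of (mmse M β (f * P) ω))) k j ≤ P * sqErr M β (f * P) k ω := by
      have hE : 0 ≤ sqErr M β (f * P) k ω := Finset.sum_nonneg fun m _ => by positivity
      calc _ ≤ ∑ j ∈ Finset.univ.erase k, P / M * sqErr M β (f * P) k ω := by
            refine Finset.sum_le_sum fun j hj => ?_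
            unfold beamPower
            gcongr
            exact hω j (Finset.ne_of_mem_erase hj)
        _ ≤ ∑ _j : Fin M, P / M * sqErr M β (f * P) k ω :=
            Finset.sum_le_sum_of_subset_of_nonneg (Finset.erase_subset _ _)
              fun _ _ _ => by positivity
        _ = P * sqErr M β (f * P) k ω := by
            simp only [Finset.sum_const, Finset.card_univ, Fintype.card_fin, nsmul_eq_mul]
            field_simp
    have := log_one_add_div_sub_le (beamPower_nonneg hP.le (Matrix.of ω.1)
      (zf (Matrix.of (mmse M β (f * P) ω))) k k) hI0 hι
    refine le_trans ?_ this
    unfold beamPower at hI ⊢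
    linarith
  have := integral_mono_ae (hint.sub (herr.const_mul P)) (integrable_trainedRate hP.le f hι β k)
    hle
  rw [integral_sub' hint (herr.const_mul P), hid.integral_eq, integral_const_mul, herr'] at this
  have hβ' : (0 : ℝ) < β := by exact_mod_cast Nat.pos_of_ne_zero hβ
  -- Pilot power scales with `P`, so the loss stays bounded at every power level.
  have heq : P * (M / (β * (f * P))) = M / (β * f) := by field_simp
  rw [heq] at this
  exact this

end Rates

/-! ### Monotonicity of the INI loss. -/

section InterferenceLoss

theorem dRINI_strictMonoOn {M : ℕ} (hM : 1 ≤ M) {P f : ℝ} (hP : 0 < P) (hf : 0 < f) :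
    StrictMonoOn (dRINI M P f) (Set.Ici 0) := by
  intro α hα α' hα' h
  have hM' : (0 : ℝ) < M := by exact_mod_cast hM
  have hx : 0 ≤ α * f * P := mul_nonneg (mul_nonneg hα hf.le) hP.le
  have hxy : α * f * P < α' * f * P := by gcongr
  have hp : 0 < P / M := by positivity
  unfold dRINI
  generalize α * f * P = x at *
  generalize α' * f * P = y at *
  generalize P / (M : ℝ) = p at *
  have hy : 0 ≤ y := hx.trans hxy.le
  refine Real.log_lt_log (by positivity) ?_
  rw [div_lt_div_iff₀ (by positivity) (by positivity)]
  have h1 : (1 + p)⁻¹ < 1 := inv_lt_one_of_one_lt₀ (by linarith)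
  rw [div_eq_mul_inv, div_eq_mul_inv]
  -- After cross-multiplication, the difference of the sides is `(y - x) * (1 - (1 + p)⁻¹)`.
  nlinarith [mul_pos (sub_pos.2 hxy) (sub_pos.2 h1)]

theorem dRINI_zero (M : ℕ) (P f : ℝ) : dRINI M P f 0 = 0 := by simp [dRINI]

theorem dRINI_nonneg {M : ℕ} (hM : 1 ≤ M) {P f α : ℝ} (hP : 0 < P) (hf : 0 < f) (hα : 0 ≤ α) :
    0 ≤ dRINI M P f α := by
  rw [← dRINI_zero M P f]
  exact (dRINI_strictMonoOn hM hP hf).monotoneOn (Set.mem_Ici.2 le_rfl) hα hα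

theorem tendsto_dRINI (M : ℕ) (P f : ℝ) :
    Filter.Tendsto (dRINI M P f) (nhds 0) (nhds 0) := by
  have h : ContinuousAt (dRINI M P f) 0 := by
    unfold dRINI
    refine ContinuousAt.log (ContinuousAt.div (by fun_prop) (by fun_prop) (by simp)) (by simp)
  simpa [ContinuousAt, dRINI_zero] using h

end InterferenceLoss

/-! ### The full-duplex gain. -/

section Gain

variable {M : ℕ}

theorem ARG_eq (P f α : ℝ) (k : Fin M) (T τ : ℕ) :
    ARG P f α k T τ = 1 / T * ∑ j ∈ Finset.Icc 2 (τ / M), (ergodicRate P f 0 k (j - 1) +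
      ((M : ℝ) - 1) * ergodicRate P f (α * f * P) k (j - 1)) := by
  have hD : ∀ τ, RDATA P f k τ = ergodicRate P f 0 k (τ / M) := fun _ => rfl
  have hI : ∀ τ, RINI P f α k τ = ergodicRate P f (α * f * P) k (τ / M) := fun _ => rfl
  unfold ARG ARCAB ARHD
  rw [add_sub_cancel_left]
  simp only [hD, hI, Nat.mul_div_cancel _ k.pos]

theorem ARG_pos {P f α : ℝ} (hP : 0 < P) (hf : 0 < f) (hα : 0 ≤ α) (k : Fin M) {T τ : ℕ}
    (hT : 0 < T) (hτ : 2 * M ≤ τ) : 0 < ARG P f α k T τ := by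
  have hM : (1 : ℝ) ≤ M := by exact_mod_cast k.pos
  have hT' : (0 : ℝ) < T := by exact_mod_cast hT
  have hN : 2 ≤ τ / M := (Nat.le_div_iff_mul_le k.pos).2 hτ
  rw [ARG_eq]
  refine mul_pos (by positivity) (Finset.sum_pos (fun j hj => ?_) ⟨2, by simp [hN]⟩)
  have hj' : j - 1 ≠ 0 := by have := (Finset.mem_Icc.1 hj).1; omega
  have h1 := ergodicRate_pos hP hf le_rfl k hj'
  have h2 := ergodicRate_nonneg hP.le f (by positivity : 0 ≤ α * f * P) k (j - 1)
  have h3 := mul_nonneg (sub_nonneg.2 hM) h2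
  linarith

theorem ARG_antitoneOn {P f : ℝ} (hP : 0 < P) (hf : 0 < f) (k : Fin M) (T τ : ℕ) :
    AntitoneOn (fun α => ARG P f α k T τ) (Set.Ici 0) := by
  intro α hα α' hα' h
  have hM : (1 : ℝ) ≤ M := by exact_mod_cast k.pos
  simp only [ARG_eq]
  refine mul_le_mul_of_nonneg_left (Finset.sum_le_sum fun j _ => ?_) (by positivity)
  refine add_le_add_right (mul_le_mul_of_nonneg_left ?_ (sub_nonneg.2 hM)) _
  exact ergodicRate_antitoneOn hP.le f k _ (mul_nonneg (mul_nonneg hα hf.le) hP.le)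
    (mul_nonneg (mul_nonneg hα' hf.le) hP.le) (by gcongr)

theorem ARG_strictAntiOn {P f : ℝ} (hP : 0 < P) (hf : 0 < f) (k : Fin M) {T τ : ℕ}
    (hT : 0 < T) (hM : 2 ≤ M) (hτ : 2 * M ≤ τ) :
    StrictAntiOn (fun α => ARG P f α k T τ) (Set.Ici 0) := by
  intro α hα α' hα' h
  have hM' : (2 : ℝ) ≤ M := by exact_mod_cast hM
  have hT' : (0 : ℝ) < T := by exact_mod_cast hT
  have hN : 2 ≤ τ / M := (Nat.le_div_iff_mul_le k.pos).2 hτ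
  simp only [ARG_eq]
  -- Cycle `j = 2` exists, and the INI rates carry the positive weight `M - 1`.
  refine mul_lt_mul_of_pos_left (Finset.sum_lt_sum_of_nonempty ⟨2, by simp [hN]⟩ fun j hj => ?_)
    (by positivity)
  have hj' : j - 1 ≠ 0 := by have := (Finset.mem_Icc.1 hj).1; omega
  refine add_lt_add_right (mul_lt_mul_of_pos_left ?_ (by linarith)) _
  exact ergodicRate_strictAntiOn hP hf k hj' (mul_nonneg (mul_nonneg hα hf.le) hP.le)
    (mul_nonneg (mul_nonneg hα' hf.le) hP.le) (by gcongr)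

theorem sum_Icc_inv_le_harmonic {N T : ℕ} (h : N ≤ T) :
    ∑ j ∈ Finset.Icc 2 N, ((j - 1 : ℕ) : ℝ)⁻¹ ≤ harmonic T := by
  rw [harmonic_eq_sum_Icc]
  simp only [Rat.cast_sum, Rat.cast_inv, Rat.cast_natCast]
  calc ∑ j ∈ Finset.Icc 2 N, ((j - 1 : ℕ) : ℝ)⁻¹
      = ∑ i ∈ (Finset.Icc 2 N).image (fun j : ℕ => j - 1), ((i : ℕ) : ℝ)⁻¹ := by
        rw [Finset.sum_image]
        intro a ha b hb hab
        have := (Finset.mem_Icc.1 ha).1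
        have := (Finset.mem_Icc.1 hb).1
        simp only at hab
        omega
    _ ≤ ∑ i ∈ Finset.Icc 1 T, (i : ℝ)⁻¹ := by
        refine Finset.sum_le_sum_of_subset_of_nonneg ?_ fun _ _ _ => by positivity
        intro i hi
        obtain ⟨j, hj, rfl⟩ := Finset.mem_image.1 hi
        have := Finset.mem_Icc.1 hj
        exact Finset.mem_Icc.2 (by omega)

theorem ARG_ge {P f α : ℝ} (hP : 0 < P) (hf : 0 < f) (hα : 0 ≤ α) (k : Fin M) {T τ : ℕ}
    (hτ : τ ≤ T) (hd : M ∣ τ) :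
    (τ : ℝ) / T * (RZF P k - dRINI M P f α) -
      1 / T * (M * RZF P k + M ^ 2 / f * harmonic T) ≤ ARG P f α k T τ := by
  have hM : (1 : ℝ) ≤ M := by exact_mod_cast k.pos
  have hp : 0 < P / M := by positivity
  obtain ⟨N, rfl⟩ := hd
  set B := RZF P k - dRINI M P f α with hB
  have hR : 0 < RZF P k := by rw [RZF_eq_rayleighRate]; exact rayleighRate_pos hp le_rfl
  have hΔ := dRINI_nonneg k.pos hP hf hα
  have hNT : N ≤ T := (Nat.le_mul_of_pos_left N k.pos).trans hτ
  -- Each of the `M` symbols of cycle `j` contributes at least `B - M / ((j - 1) * f)`; for the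
  -- INI-free symbol this wastes `dRINI ≥ 0`.
  have hterm : ∀ j ∈ Finset.Icc 2 N, M * B - M ^ 2 / f * ((j - 1 : ℕ) : ℝ)⁻¹ ≤
      ergodicRate P f 0 k (j - 1) + ((M : ℝ) - 1) * ergodicRate P f (α * f * P) k (j - 1) := by
    intro j hj
    have hj' : j - 1 ≠ 0 := by have := (Finset.mem_Icc.1 hj).1; omega
    have h1 := ergodicRate_ge_rayleighRate hP hf le_rfl k hj'
    have hι : 0 ≤ α * f * P := by positivity
    have h2 := ergodicRate_ge_rayleighRate hP hf hι k hj'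
    have h3 := rayleighRate_ge hp.le hι
    rw [← RZF_eq_rayleighRate P k] at h1 h3
    have h4 : B - M / ((j - 1 : ℕ) * f) ≤ ergodicRate P f (α * f * P) k (j - 1) := by
      have : B ≤ rayleighRate (P / M) (α * f * P) := h3
      linarith
    have h5 := mul_le_mul_of_nonneg_left h4 (sub_nonneg.2 hM)
    have h6 : (M : ℝ) ^ 2 / f * ((j - 1 : ℕ) : ℝ)⁻¹ = M * (M / ((j - 1 : ℕ) * f)) := by
      rw [div_eq_mul_inv, div_eq_mul_inv, mul_inv]; ring
    rw [h6]
    nlinarith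
  have hsum := Finset.sum_le_sum hterm
  rw [Finset.sum_sub_distrib, ← Finset.mul_sum (Finset.Icc 2 N) _ ((M : ℝ) ^ 2 / f),
    Finset.sum_const, Nat.card_Icc, nsmul_eq_mul] at hsum
  have hh := mul_le_mul_of_nonneg_left (sum_Icc_inv_le_harmonic hNT)
    (by positivity : 0 ≤ (M : ℝ) ^ 2 / f)
  -- The silent first cycle costs `M * B`. As `B` may be negative, the cost is bounded by `M * RZF P
  -- k`, which is positive and also covers `N = 0`, where the truncated count is `0`.
  have hcard : N * (M * B) - M * RZF P k ≤ ((N + 1 - 2 : ℕ) : ℝ) * (M * B) := by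
    rcases N with _ | n
    · have : 0 < M * RZF P k := by positivity
      simp
      linarith
    · have h7 : M * B ≤ M * RZF P k := by gcongr; linarith
      have h8 : n + 1 + 1 - 2 = n := by omega
      rw [h8]
      push_cast
      linarith
  rw [ARG_eq, Nat.mul_div_cancel_left _ k.pos]
  have hfin : N * (M * B) - (M * RZF P k + M ^ 2 / f * harmonic T) ≤
      ∑ j ∈ Finset.Icc 2 N, (ergodicRate P f 0 k (j - 1) +
        ((M : ℝ) - 1) * ergodicRate P f (α * f * P) k (j - 1)) := by
    linarith
  refine le_trans (le_of_eq ?_) (mul_le_mul_of_nonneg_left hfin (by positivity))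
  push_cast
  ring

/-- The harmonic number is at most `1 + log T = o(√T)`, and `√T / T = 1 / √T`. -/
theorem isLittleO_harmonic_div (a b : ℝ) :
    (fun T : ℕ => 1 / (T : ℝ) * (a + b * harmonic T)) =o[Filter.atTop]
      fun T : ℕ => 1 / Real.sqrt (T : ℝ) := by
  have hconst : ∀ c : ℝ, (fun _ : ℝ => c) =o[Filter.atTop] Real.sqrt := fun c =>
    Asymptotics.isLittleO_const_left.2 (.inr
      (Filter.tendsto_abs_atTop_atTop.comp Real.tendsto_sqrt_atTop))
  have hlog : (fun x : ℝ => 1 + Real.log x) =o[Filter.atTop] Real.sqrt := by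
    refine (hconst 1).add ?_
    have := isLittleO_log_rpow_atTop (r := 1 / 2) (by norm_num)
    simpa only [← Real.sqrt_eq_rpow] using this
  have hharm : (fun T : ℕ => (harmonic T : ℝ)) =o[Filter.atTop] fun T : ℕ => Real.sqrt (T : ℝ) := by
    refine Asymptotics.IsBigO.trans_isLittleO (.of_bound 1 (.of_forall fun T => ?_))
      (hlog.comp_tendsto tendsto_natCast_atTop_atTop)
    have h0 : (0 : ℝ) ≤ harmonic T := by
      rw [harmonic]; push_cast; exact Finset.sum_nonneg fun _ _ => by positivity
    rw [Real.norm_eq_abs, abs_of_nonneg h0, one_mul]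
    exact (harmonic_le_one_add_log T).trans (le_abs_self _)
  have hnum := ((hconst a).comp_tendsto tendsto_natCast_atTop_atTop).add (hharm.const_mul_left b)
  refine ((Asymptotics.isBigO_refl (fun T : ℕ => 1 / (T : ℝ)) Filter.atTop).mul_isLittleO
    hnum).congr_right fun T => ?_
  simp only [Function.comp_apply]
  rw [one_div_mul_eq_div, Real.sqrt_div_self', one_div]

end Gain

end CAB

theorem mainTheorem4 (M : ℕ) (hM : 1 ≤ M) (P f : ℝ) (hP : 0 < P) (hf : 0 < f) (hf1 : f ≤ 1) :
    -- all ergodic rates are expectations of integrable functions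
    (∀ k : Fin M, Integrable (CAB.genieRate P k) (CAB.channelLaw M) ∧
      ∀ (β : ℕ) (ι : ℝ), 0 ≤ ι →
        Integrable (CAB.trainedRate P f ι β k) (CAB.blockLaw M β)) ∧
    -- the lower bound on the gain, uniformly in the training length
    (∀ α : ℝ, 0 < α → ∃ ε : ℕ → ℝ,
      ε =o[Filter.atTop] (fun T : ℕ => 1 / Real.sqrt (T : ℝ)) ∧
      ∀ (k : Fin M) (T τ : ℕ), 0 < T → τ ≤ T → M ∣ τ →
        CAB.ARG P f α k T τ ≥
          (τ : ℝ) / T * (CAB.RZF P k - CAB.dRINI M P f α) - ε T) ∧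
    -- the gain is positive
    (∀ α : ℝ, 0 < α → ∀ (k : Fin M) (T τ : ℕ), τ ≤ T → M ∣ τ → 2 * M ≤ τ →
      0 < CAB.ARG P f α k T τ) ∧
    -- the gain is larger when the inter-node interference is lower
    (∀ (k : Fin M) (T τ : ℕ), 0 < T → τ ≤ T → M ∣ τ →
      AntitoneOn (fun α => CAB.ARG P f α k T τ) (Set.Ici 0) ∧
      (2 ≤ M → 2 * M ≤ τ → StrictAntiOn (fun α => CAB.ARG P f α k T τ) (Set.Ici 0))) ∧
    -- and so is the bracket in the lower bound, which approaches the positive rate `RZF`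
    (∀ k : Fin M, 0 < CAB.RZF P k ∧
      StrictAntiOn (fun α => CAB.RZF P k - CAB.dRINI M P f α) (Set.Ici 0) ∧
      Filter.Tendsto (fun α => CAB.RZF P k - CAB.dRINI M P f α)
        (nhdsWithin 0 (Set.Ioi 0)) (nhds (CAB.RZF P k))) := by
  have hp : ∀ k : Fin M, 0 < P / M := fun k => by
    have : (0 : ℝ) < M := by exact_mod_cast k.pos
    positivity
  refine ⟨fun k => ⟨CAB.integrable_genieRate hP.le k, fun β ι hι =>
      CAB.integrable_trainedRate hP.le f hι β k⟩, fun α hα => ?_,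
    fun α hα k T τ hτ _ h2 => CAB.ARG_pos hP hf hα.le k (by omega) h2,
    fun k T τ hT _ _ => ⟨CAB.ARG_antitoneOn hP hf k T τ, fun hM2 h2 =>
      CAB.ARG_strictAntiOn hP hf k hT hM2 h2⟩, fun k => ⟨?_, ?_, ?_⟩⟩
  -- The witness is written with `rayleighRate` because it must be fixed before the user `k`.
  · refine ⟨_, CAB.isLittleO_harmonic_div (M * CAB.rayleighRate (P / M) 0) (M ^ 2 / f),
      fun k T τ _ hτ hd => ?_⟩
    have := CAB.ARG_ge hP hf hα.le k hτ hd
    rwa [CAB.RZF_eq_rayleighRate] at this ⊢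
  · rw [CAB.RZF_eq_rayleighRate]
    exact CAB.rayleighRate_pos (hp k) le_rfl
  · exact fun a ha b hb hab => sub_lt_sub_left (CAB.dRINI_strictMonoOn hM hP hf ha hb hab) _
  · have := (CAB.tendsto_dRINI M P f).const_sub (CAB.RZF P k)
    rw [sub_zero] at this
    exact this.mono_left nhdsWithin_le_nhds
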